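/- **Setting.** Let $g,\sigma>0$, $[\![\gamma]\!]\in[-\sigma,\sigma]$, $\gamma:=\arcsin(-[\![\gamma]\!]/\sigma)\in[-\frac\pi2,\frac\pi2]$, and let $\theta_1>0$, $\theta_2\ge 0$ with $\theta_1+\theta_2<\pi$. Put $\psi_1:=\gamma+\frac\pi2-\theta_1$, $\psi_2:=-\gamma-\frac\pi2+\theta_2$, and assume that $\psi_1<0$ and $\psi_2<0$. *Profiles.* A profile is a curve $(x,y)(s)$, $0\le s\le L$, $L>0$, parametrized by arc length, with slope angle $\psi$, such that $x'=\cos\psi$, $y'=\sin\psi$, $\sigma\psi'=gy$, $\psi(0)=\psi_1$, $\psi(L)=\psi_2$, and $\psi$ attains its maximum $\psi_m$ at exactly one point $(x_m,u_m)$ of the curve. (For a graph $y=u(x)$ the equation reads $\sigma\big(u'/\sqrt{1+u'^2}\big)'=gu$.) *Vessel.* For $P_0\in\mathbb R$ let $O=(0,-P_0/g)$. A profile spans the vessel with vertex $O$ if it starts on the left wall (the ray from $O$ with polar angle $\pi-\theta_1$), ends on the right wall (the ray with polar angle $\theta_2$), in between has strictly decreasing polar angle about $O$, and does not pass through $O$.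 Then $x_1=x(0)$ and $x_2=x(L)$ are the abscissas of the contact points, and $\mathscr V$ is the area of the region enclosed by the curve and the two walls. The curve $(x,\,y+P_0/g)$ solves $\sigma\psi'=gy-P_0$ in the vessel with vertex $(0,0)$; it is called the corresponding steady surface of volume $\mathscr V$. **Theorem.** Let $M=\max(\psi_1,\psi_2)$. (i) *Maximum at a wall.* Let $\psi_1\ne\psi_2$ and $\psi_m=M$. If $\psi_2<\psi_1$, put $I=(-\infty,0]$ and $e=-\infty$; if $\psi_1<\psi_2$, put $I=[0,\infty)$ and $e=+\infty$. For all $x_m\in\mathbb R$ and $u_m\in I$ there is a profile with maximal slope angle $\psi_m$, attained at $(x_m,u_m)$. Profiles with maximal slope angle $\psi_m$ that span a vessel exist exactly for $u_m\in I$, and for them $x_m,\mathscr V,P_0,x_1,x_2$ are functions of $u_m$. Moreover $\mathscr V(u_m)\to0$ as $u_m\to e$; $\mathscr V$ is bounded above, and $V_1:=\max_I\mathscr V$ exists and equals $\sup_{I\setminus\{0\}}\mathscr V$. For every $V$ with $0<V\le V_1$ there are $u_m\in I$ with $\mathscr V(u_m)=V$ and a corresponding steady surface of volume $V$. (ii)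 *Interior maximum.* Let $\psi_m\in(M,0)$. Every profile with maximal slope angle $\psi_m$ attains it in the interior, and has $u_m=0$; for each $x_m\in\mathbb R$ there is such a profile. Those that span a vessel exist, and for them $x_m,\mathscr V,P_0,x_1,x_2$ are functions of $\psi_m$. Moreover $\mathscr V(\psi_m)\to+\infty$ as $\psi_m\to0^-$, and $\mathscr V$ is bounded below on $(M,0)$; let $V_m:=\inf_{(M,0)}\mathscr V$. For every $V>V_m$ there are $\psi_m\in(M,0)$ with $\mathscr V(\psi_m)=V$ and a corresponding steady surface of volume $V$. If $\psi_1\ne\psi_2$, there is also a steady surface of volume $V_m$, with $u_m=0$ and some maximal slope angle $\psi_m\in[M,0)$; if $\psi_1=\psi_2$, then $V_m=0$. If in addition $\psi_1,\psi_2>-\frac\pi2$, then the profiles whose existence is asserted can be taken to be graphs of functions $u$ of $x$, and the steady surfaces can be taken to be graphs of functions $v$ on $[x_1,x_2]$ with $x_1<x_2$, $\sigma\big(v'/\sqrt{1+v'^2}\big)'=gv-P_0$, and $v'/\sqrt{1+v'^2}=\sin\psi_i$ at $x_i$ for $i=1,2$. -/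

import Mathlib

open Real Set Filter Topology MeasureTheory

noncomputable section

namespace Capillary

/-- The physical data: gravity `g`, surface tension `σ`, the jump `⟦γ⟧` of the solid free energies,
and the inclinations `θ₁` (left wall) and `θ₂` (right wall), measured from the horizontal.  A
horizontal right wall is allowed. -/
structure Setup where
  g : ℝ
  σ : ℝ
  jump : ℝ
  θ₁ : ℝ
  θ₂ : ℝ
  g_pos : 0 < g
  σ_pos : 0 < σ
  neg_one_le : -1 ≤ jump / σ
  le_one : jump / σ ≤ 1
  θ₁_pos : 0 < θ₁
  θ₂_nonneg : 0 ≤ θ₂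
  angle_sum : θ₁ + θ₂ < π

/-- `γ ∈ [-π/2, π/2]` with `sin γ = -⟦γ⟧ / σ`. -/
def Setup.γ (D : Setup) : ℝ := Real.arcsin (-(D.jump / D.σ))

/-- The slope angle which the surface must have on the left wall. -/
def Setup.ψ₁ (D : Setup) : ℝ := D.γ + π / 2 - D.θ₁

/-- The slope angle which the surface must have on the right wall. -/
def Setup.ψ₂ (D : Setup) : ℝ := -D.γ - π / 2 + D.θ₂

/-- The capillary equation `σ dψ/ds = g y - P₀` for a plane curve `(x, y)` with slope angle `ψ`,
parametrized by arc length `s ∈ [0, L]`.  Where the curve is a graph over the `x`-axis this is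
`σ d(sin ψ)/dx = g y - P₀`; it also makes sense where the tangent is vertical.
The case `P₀ = 0` is the equation in vertically shifted coordinates. -/
def SolvesCurve (D : Setup) (P₀ L : ℝ) (x y ψ : ℝ → ℝ) : Prop :=
  ∀ s ∈ Icc 0 L,
    HasDerivWithinAt x (cos (ψ s)) (Icc 0 L) s ∧
    HasDerivWithinAt y (sin (ψ s)) (Icc 0 L) s ∧
    HasDerivWithinAt ψ ((D.g * y s - P₀) / D.σ) (Icc 0 L) s

/-- The boundary value problem for a surface which is the graph of `v` over `[x₁, x₂]`:
`σ (v' / √(1 + v'²))' = g v - P₀`, with `v' / √(1 + v'²)` equal to `sin ψ₁` at `x₁` and to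
`sin ψ₂` at `x₂`.  Here `p` is the derivative of `v`. -/
def SolvesCartesian (D : Setup) (P₀ x₁ x₂ : ℝ) (v : ℝ → ℝ) : Prop :=
  x₁ < x₂ ∧ ∃ p : ℝ → ℝ,
    (∀ x ∈ Icc x₁ x₂,
      HasDerivWithinAt v (p x) (Icc x₁ x₂) x ∧
      HasDerivWithinAt (fun z => p z / √(1 + p z ^ 2)) ((D.g * v x - P₀) / D.σ) (Icc x₁ x₂) x) ∧
    p x₁ / √(1 + p x₁ ^ 2) = sin D.ψ₁ ∧
    p x₂ / √(1 + p x₂ ^ 2) = sin D.ψ₂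

/-- The curve `(x, y)`, traversed from left to right, is the graph of a function that solves the
boundary value problem with constant `P₀`. -/
def IsCartesianSolution (D : Setup) (P₀ L : ℝ) (x y : ℝ → ℝ) : Prop :=
  StrictMonoOn x (Icc 0 L) ∧
  ∃ v : ℝ → ℝ, (∀ s ∈ Icc 0 L, v (x s) = y s) ∧ SolvesCartesian D P₀ (x 0) (x L) v

/-- A nondegenerate solution curve in shifted coordinates whose slope angle runs from `ψ₁` to `ψ₂`
and attains its maximum `ψm` at exactly one point, namely `(xm, um)`, of parameter `sm`. -/
def IsProfile (D : Setup) (ψm xm um : ℝ) (L sm : ℝ) (x y ψ : ℝ → ℝ) : Prop :=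
  0 < L ∧ SolvesCurve D 0 L x y ψ ∧ ψ 0 = D.ψ₁ ∧ ψ L = D.ψ₂ ∧
  sm ∈ Icc 0 L ∧ x sm = xm ∧ y sm = um ∧ ψ sm = ψm ∧
  ∀ s ∈ Icc 0 L, s ≠ sm → ψ s < ψm

/-- In shifted coordinates the walls meet at `O = (0, -P₀/g)`.  The curve starts on the left wall
(polar angle `π - θ₁` about `O`), ends on the right wall (polar angle `θ₂`), and in between stays
inside the vessel and meets every ray from `O` exactly once. -/
def SpansVessel (D : Setup) (P₀ L : ℝ) (x y : ℝ → ℝ) : Prop :=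
  ∃ ρ φ : ℝ → ℝ,
    (∀ s ∈ Icc 0 L,
      0 < ρ s ∧ x s = ρ s * cos (φ s) ∧ y s + P₀ / D.g = ρ s * sin (φ s)) ∧
    StrictAntiOn φ (Icc 0 L) ∧ φ 0 = π - D.θ₁ ∧ φ L = D.θ₂

/-- The region enclosed by the two walls and a curve that spans the vessel: all the segments from
`O = (0, -P₀/g)` to points of the curve. -/
def fluidRegion (D : Setup) (P₀ L : ℝ) (x y : ℝ → ℝ) : Set (ℝ × ℝ) :=
  {q | ∃ s ∈ Icc 0 L, ∃ t ∈ Icc (0 : ℝ) 1,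
    q = (t * x s, -(P₀ / D.g) + t * (y s + P₀ / D.g))}

/-- The volume of the fluid: the area (Lebesgue measure) of the enclosed region. -/
def fluidVolume (D : Setup) (P₀ L : ℝ) (x y : ℝ → ℝ) : ℝ :=
  (volume (fluidRegion D P₀ L x y)).toReal

/-- There is a solution curve with maximal slope angle `ψm`, attained at `(xm, um)`, which meets the
two walls with slope angles `ψ₁` and `ψ₂` at points of abscissas `x₁` and `x₂`, where `P₀` is the
constant that fixes the position of `O`, and which encloses the volume `V`. -/
def Realizes (D : Setup) (ψm um xm P₀ x₁ x₂ V : ℝ) : Prop :=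
  ∃ (L sm : ℝ) (x y ψ : ℝ → ℝ), IsProfile D ψm xm um L sm x y ψ ∧ SpansVessel D P₀ L x y ∧
    x 0 = x₁ ∧ x L = x₂ ∧ fluidVolume D P₀ L x y = V

/-- There is a solution of equation and boundary conditions in shifted coordinates with maximal slope
angle `ψm`, attained at `(xm, um)`.  It is a graph as soon as both contact angles are acute. -/
def HasProfile (D : Setup) (ψm xm um : ℝ) : Prop :=
  ∃ (L sm : ℝ) (x y ψ : ℝ → ℝ), IsProfile D ψm xm um L sm x y ψ ∧
    (-(π / 2) < D.ψ₁ → -(π / 2) < D.ψ₂ → IsCartesianSolution D 0 L x y)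

/-- There is a steady surface of volume `V` whose maximal slope angle is `ψm`, attained at height
`um` in shifted coordinates: for some `P₀` the curve `(x, y + P₀/g)` solves the capillary equation
with constant `P₀` in the vessel with vertex at the origin, with the prescribed contact angles.
As soon as both contact angles are acute it is the graph of a solution `v` of the boundary value
problem with constant `P₀`. -/
def HasSteadySurface (D : Setup) (ψm um V : ℝ) : Prop :=
  ∃ (P₀ xm L sm : ℝ) (x y ψ : ℝ → ℝ), IsProfile D ψm xm um L sm x y ψ ∧ SpansVessel D P₀ L x y ∧
    fluidVolume D P₀ L x y = V ∧
    SolvesCurve D P₀ L x (fun s => y s + P₀ / D.g) ψ ∧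
    (-(π / 2) < D.ψ₁ → -(π / 2) < D.ψ₂ →
      IsCartesianSolution D P₀ L x (fun s => y s + P₀ / D.g))

end Capillary

end

noncomputable section

namespace Capillary

/-! ### One-variable calculus on a compact interval -/

/-! With κ = g/σ, the energy cos ψ + κ y²/2 is constant along a solution. As long as ψ stays in (-π,
0), the height y decreases strictly and can serve as parameter, and dx/dy = cot ψ depends only on
the energy c and the height. Up to horizontal translation such a curve is therefore known from c and
its end heights a > b. The slope angle is largest where y² is least, hence either in the interior at
height 0 or at a wall. So ψm and um determine (c, a, b) (`Shape.unique`), and every admissible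
triple comes from a curve (`Shape.exists_arc`).

The horizontal extent X and the vertical extent b - a fix the contact points on the walls, through a
linear system of determinant sin (θ₁ + θ₂). A curve placed in this way spans the vessel, because the
cross product of tangent and position vector, `moment`, is positive in its interior
(`IsArc.spansVessel`). Conversely, a spanning profile has ψ in (-π, 0) (`SpansVessel.isArc`).
Together these give `Shape.realizes_iff`: all quantities are explicit functions of ψm and um.

The area is half the integral of `moment`. Since κ y = ψ', the integral of y dx is elementary, and
the area is a quadratic polynomial in X with coefficients depending on a and b (`integral_moment`).
It depends continuously on the parameter. For a maximum at a wall, cot ψ stays bounded while a - b →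
0 as |um| → ∞, so the area tends to 0 (`tendsto_area_zero`). For an interior maximum, the curve
flattens near height 0 as ψm → 0; there -cot ψ is at least a multiple of 1/y down to the scale √(1 -
cos ψm), so X diverges logarithmically (`width_ge_log`), and the area with it
(`tendsto_interiorArea`). Compactness and the intermediate value theorem do the rest. -/

theorem continuousOn_of_hasDerivWithinAt_Icc {f f' : ℝ → ℝ} {L : ℝ}
    (h : ∀ s ∈ Icc 0 L, HasDerivWithinAt f (f' s) (Icc 0 L) s) : ContinuousOn f (Icc 0 L) :=
  fun s hs => (h s hs).continuousWithinAt

theorem hasDerivAt_of_mem_Ioo {f f' : ℝ → ℝ} {L s : ℝ}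
    (h : ∀ s ∈ Icc 0 L, HasDerivWithinAt f (f' s) (Icc 0 L) s) (hs : s ∈ Ioo 0 L) :
    HasDerivAt f (f' s) s :=
  (h s (Ioo_subset_Icc_self hs)).hasDerivAt (Icc_mem_nhds hs.1 hs.2)

theorem strictMonoOn_of_derivWithin_Icc {f f' : ℝ → ℝ} {L p q : ℝ}
    (h : ∀ s ∈ Icc 0 L, HasDerivWithinAt f (f' s) (Icc 0 L) s) (hp : 0 ≤ p) (hq : q ≤ L)
    (pos : ∀ s ∈ Ioo p q, 0 < f' s) : StrictMonoOn f (Icc p q) := by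
  refine strictMonoOn_of_hasDerivWithinAt_pos (f' := f') (convex_Icc p q)
    ((continuousOn_of_hasDerivWithinAt_Icc h).mono (Icc_subset_Icc hp hq)) ?_ ?_
  · rw [interior_Icc]
    exact fun s hs => (hasDerivAt_of_mem_Ioo h ⟨hp.trans_lt hs.1, hs.2.trans_le hq⟩).hasDerivWithinAt
  · rwa [interior_Icc]

theorem strictAntiOn_of_derivWithin_Icc {f f' : ℝ → ℝ} {L p q : ℝ}
    (h : ∀ s ∈ Icc 0 L, HasDerivWithinAt f (f' s) (Icc 0 L) s) (hp : 0 ≤ p) (hq : q ≤ L)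
    (neg : ∀ s ∈ Ioo p q, f' s < 0) : StrictAntiOn f (Icc p q) := by
  have := strictMonoOn_of_derivWithin_Icc (f := fun s => -f s) (f' := fun s => -f' s)
    (fun s hs => (h s hs).neg) hp hq (fun s hs => by simpa using neg s hs)
  exact fun _ hs _ ht hst => by simpa using this hs ht hst

theorem eq_of_derivWithin_Icc_zero {f : ℝ → ℝ} {L : ℝ}
    (h : ∀ s ∈ Icc 0 L, HasDerivWithinAt f 0 (Icc 0 L) s) : ∀ s ∈ Icc 0 L, f s = f 0 :=
  constant_of_has_deriv_right_zero (fun s hs => (h s hs).continuousWithinAt) fun s hs =>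
    (h s (Ico_subset_Icc_self hs)).mono_of_mem_nhdsWithin
      (mem_of_superset (Ico_mem_nhdsGE hs.2)
        (fun _ ht => ⟨hs.1.trans ht.1, ht.2.le⟩))

theorem integral_eq_sub_of_derivWithin_Icc {f f' : ℝ → ℝ} {L s : ℝ} (hs : s ∈ Icc 0 L)
    (h : ∀ s ∈ Icc 0 L, HasDerivWithinAt f (f' s) (Icc 0 L) s) (hc : ContinuousOn f' (Icc 0 L)) :
    ∫ r in 0..s, f' r = f s - f 0 := by
  have hsub : uIcc 0 s ⊆ Icc 0 L := by
    rw [uIcc_of_le hs.1]; exact Icc_subset_Icc le_rfl hs.2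
  refine intervalIntegral.integral_eq_sub_of_hasDeriv_right
    ((continuousOn_of_hasDerivWithinAt_Icc h).mono hsub) ?_ ((hc.mono hsub).intervalIntegrable)
  intro r hr
  rw [min_eq_left hs.1, max_eq_right hs.1] at hr
  exact (hasDerivAt_of_mem_Ioo h ⟨hr.1, hr.2.trans_le hs.2⟩).hasDerivWithinAt

/-! ### The angles -/

namespace Setup
variable (D : Setup)

/-- The inverse square of the capillary length. -/
def κ : ℝ := D.g / D.σ

theorem κ_pos : 0 < D.κ := div_pos D.g_pos D.σ_pos

theorem γ_le : D.γ ≤ π / 2 := Real.arcsin_le_pi_div_two _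

theorem le_γ : -(π / 2) ≤ D.γ := Real.neg_pi_div_two_le_arcsin _

theorem neg_θ₁_le_ψ₁ : -D.θ₁ ≤ D.ψ₁ := by
  have := D.le_γ; unfold ψ₁; linarith

theorem θ₂_sub_pi_le_ψ₂ : D.θ₂ - π ≤ D.ψ₂ := by
  have := D.γ_le; unfold ψ₂; linarith

theorem ψ₁_add_ψ₂ : D.ψ₁ + D.ψ₂ = D.θ₂ - D.θ₁ := by
  unfold ψ₁ ψ₂; ring

theorem θ₁_lt_pi : D.θ₁ < π := by
  have := D.angle_sum; have := D.θ₂_nonneg; linarith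

theorem θ₂_lt_pi : D.θ₂ < π := by
  have := D.angle_sum; have := D.θ₁_pos; linarith

theorem sin_add_pos : 0 < sin (D.θ₁ + D.θ₂) :=
  sin_pos_of_pos_of_lt_pi (by have := D.θ₁_pos; have := D.θ₂_nonneg; linarith) D.angle_sum

theorem sin_θ₁_pos : 0 < sin D.θ₁ := sin_pos_of_pos_of_lt_pi D.θ₁_pos D.θ₁_lt_pi

theorem sin_θ₂_nonneg : 0 ≤ sin D.θ₂ := sin_nonneg_of_nonneg_of_le_pi D.θ₂_nonneg D.θ₂_lt_pi.le

variable {D}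

theorem neg_pi_lt_ψ₁ : -π < D.ψ₁ := by
  have := D.neg_θ₁_le_ψ₁; have := D.θ₁_lt_pi; linarith

theorem neg_pi_lt_ψ₂ (h₁ : D.ψ₁ < 0) : -π < D.ψ₂ := by
  have := D.ψ₁_add_ψ₂; have := D.θ₁_lt_pi; have := D.θ₂_nonneg; linarith

/-- A slope angle above one of the two contact angles points to the right of the left wall and
below the right wall. -/
theorem angles_mem_of_lt (h₁ : D.ψ₁ < 0) (h₂ : D.ψ₂ < 0) {t : ℝ} (ht : t < 0)
    (h : D.ψ₁ < t ∨ D.ψ₂ < t) : D.θ₁ + t ∈ Ioo 0 π ∧ D.θ₂ - t ∈ Ioo 0 π := by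
  have a1 := D.neg_θ₁_le_ψ₁
  have a2 := D.θ₂_sub_pi_le_ψ₂
  have a3 := D.ψ₁_add_ψ₂
  have a4 := D.θ₁_lt_pi
  have a5 := D.θ₂_nonneg
  have a6 := D.angle_sum
  rcases h with h | h <;> refine ⟨⟨?_, ?_⟩, ⟨?_, ?_⟩⟩ <;> linarith

end Setup

theorem strictMonoOn_cos_neg : StrictMonoOn cos (Icc (-π) 0) := by
  intro a ha b hb hab
  rw [← cos_neg a, ← cos_neg b]
  exact strictAntiOn_cos ⟨by linarith [hb.2], by linarith [hb.1]⟩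
    ⟨by linarith [ha.2], by linarith [ha.1]⟩ (by linarith)

theorem cos_lt_cos_iff_neg {a b : ℝ} (ha : a ∈ Ioo (-π) 0) (hb : b ∈ Ioo (-π) 0) :
    cos a < cos b ↔ a < b :=
  strictMonoOn_cos_neg.lt_iff_lt (Ioo_subset_Icc_self ha) (Ioo_subset_Icc_self hb)

theorem cos_mem_Ioo {a : ℝ} (ha : a ∈ Ioo (-π) 0) : cos a ∈ Ioo (-1 : ℝ) 1 := by
  have := pi_pos
  constructor
  · have := strictMonoOn_cos_neg ⟨le_rfl, by linarith⟩ (Ioo_subset_Icc_self ha) ha.1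
    rwa [cos_neg, cos_pi] at this
  · have := strictMonoOn_cos_neg (Ioo_subset_Icc_self ha) ⟨by linarith, le_rfl⟩ ha.2
    rwa [cos_zero] at this

theorem sin_eq_neg_sqrt {a : ℝ} (ha : a ∈ Ioo (-π) 0) : sin a = -√(1 - cos a ^ 2) := by
  have h : sin a < 0 := sin_neg_of_neg_of_neg_pi_lt ha.2 ha.1
  rw [← sin_sq, Real.sqrt_sq_eq_abs, abs_of_neg h, neg_neg]

/-! ### Arcs with slope angle in `(-π, 0)` -/

/-- The negative cotangent of the slope angle at height `η`, for a solution curve of energy `c`. -/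
def slopeCot (D : Setup) (c η : ℝ) : ℝ :=
  (c - D.κ * η ^ 2 / 2) / √(1 - (c - D.κ * η ^ 2 / 2) ^ 2)

/-- The horizontal distance between the heights `a` and `b` on a solution curve of energy `c`. -/
def width (D : Setup) (c a b : ℝ) : ℝ := ∫ η in b..a, slopeCot D c η

/-- A solution curve whose slope angle runs from `ψ₁` to `ψ₂` inside `(-π, 0)`. -/
structure IsArc (D : Setup) (L : ℝ) (x y ψ : ℝ → ℝ) : Prop where
  pos : 0 < L
  ode : SolvesCurve D 0 L x y ψ
  left : ψ 0 = D.ψ₁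
  right : ψ L = D.ψ₂
  mem : ∀ s ∈ Icc 0 L, ψ s ∈ Ioo (-π) 0

/-- The heights `a`, `b` of the end points and the energy `c` that belong to a maximal slope angle
`ψm` attained at height `um`. -/
structure Shape (D : Setup) (ψm um c a b : ℝ) : Prop where
  lt : b < a
  mem : um ∈ Icc b a
  angle : ψm ∈ Ioo (-π) 0
  energy : c = cos ψm + D.κ * um ^ 2 / 2
  left : cos D.ψ₁ = c - D.κ * a ^ 2 / 2
  right : cos D.ψ₂ = c - D.κ * b ^ 2 / 2
  up : um < a → 0 ≤ um
  down : b < um → um ≤ 0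

theorem SolvesCurve.x {D : Setup} {P₀ L : ℝ} {x y ψ : ℝ → ℝ} (h : SolvesCurve D P₀ L x y ψ) :
    ∀ s ∈ Icc 0 L, HasDerivWithinAt x (cos (ψ s)) (Icc 0 L) s := fun s hs => (h s hs).1

theorem SolvesCurve.y {D : Setup} {P₀ L : ℝ} {x y ψ : ℝ → ℝ} (h : SolvesCurve D P₀ L x y ψ) :
    ∀ s ∈ Icc 0 L, HasDerivWithinAt y (sin (ψ s)) (Icc 0 L) s := fun s hs => (h s hs).2.1

theorem SolvesCurve.ψ {D : Setup} {L : ℝ} {x y ψ : ℝ → ℝ} (h : SolvesCurve D 0 L x y ψ) :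
    ∀ s ∈ Icc 0 L, HasDerivWithinAt ψ (D.κ * y s) (Icc 0 L) s := fun s hs => by
  convert (h s hs).2.2 using 1
  unfold Setup.κ; ring

theorem SolvesCurve.continuousOn_ψ {D : Setup} {P₀ L : ℝ} {x y ψ : ℝ → ℝ}
    (h : SolvesCurve D P₀ L x y ψ) : ContinuousOn ψ (Icc 0 L) :=
  fun s hs => (h s hs).2.2.continuousWithinAt

namespace IsArc
variable {D : Setup} {L : ℝ} {x y ψ : ℝ → ℝ}

theorem zero_mem (h : IsArc D L x y ψ) : (0 : ℝ) ∈ Icc 0 L := ⟨le_rfl, h.pos.le⟩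

theorem L_mem (h : IsArc D L x y ψ) : L ∈ Icc 0 L := ⟨h.pos.le, le_rfl⟩

theorem sin_neg (h : IsArc D L x y ψ) {s : ℝ} (hs : s ∈ Icc 0 L) : sin (ψ s) < 0 :=
  sin_neg_of_neg_of_neg_pi_lt (h.mem s hs).2 (h.mem s hs).1

theorem strictAntiOn_y (h : IsArc D L x y ψ) : StrictAntiOn y (Icc 0 L) :=
  strictAntiOn_of_derivWithin_Icc h.ode.y le_rfl le_rfl
    fun _ hs => h.sin_neg (Ioo_subset_Icc_self hs)

theorem energy (h : IsArc D L x y ψ) {s t : ℝ} (hs : s ∈ Icc 0 L) (ht : t ∈ Icc 0 L) :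
    cos (ψ s) + D.κ * y s ^ 2 / 2 = cos (ψ t) + D.κ * y t ^ 2 / 2 := by
  have key : ∀ s ∈ Icc 0 L, HasDerivWithinAt (fun s => cos (ψ s) + D.κ * y s ^ 2 / 2) 0
      (Icc 0 L) s := by
    intro s hs
    refine ((h.ode.ψ s hs).cos.add
      ((((h.ode.y s hs).pow 2).const_mul D.κ).div_const 2)).congr_deriv ?_
    push_cast; ring
  have := eq_of_derivWithin_Icc_zero key
  rw [this s hs, this t ht]

/-- An interior height lies strictly between the end heights, so its square is smaller than that of
one of them. By the energy, smaller y² means larger cos ψ, hence larger ψ. -/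
theorem lt_ψ (h : IsArc D L x y ψ) {s : ℝ} (hs : s ∈ Ioo 0 L) : D.ψ₁ < ψ s ∨ D.ψ₂ < ψ s := by
  have hs' := Ioo_subset_Icc_self hs
  have h0 := h.strictAntiOn_y h.zero_mem hs' hs.1
  have h1 := h.strictAntiOn_y hs' h.L_mem hs.2
  have e0 := h.energy hs' h.zero_mem
  have e1 := h.energy hs' h.L_mem
  have k := D.κ_pos
  rw [← h.left, ← h.right, ← cos_lt_cos_iff_neg (h.mem _ h.zero_mem) (h.mem _ hs'),
    ← cos_lt_cos_iff_neg (h.mem _ h.L_mem) (h.mem _ hs')]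
  have : y s ^ 2 < y 0 ^ 2 ∨ y s ^ 2 < y L ^ 2 := by
    rcases le_total 0 (y s) with h2 | h2
    · left; nlinarith
    · right; nlinarith
  rcases this with h2 | h2
  · left; nlinarith
  · right; nlinarith

theorem strictMonoOn_ψ (h : IsArc D L x y ψ) {sm : ℝ} (hsm : sm ∈ Icc 0 L)
    (h0 : 0 < sm → 0 ≤ y sm) : StrictMonoOn ψ (Icc 0 sm) :=
  strictMonoOn_of_derivWithin_Icc h.ode.ψ le_rfl hsm.2 fun _ hs =>
    mul_pos D.κ_pos ((h0 (hs.1.trans hs.2)).trans_lt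
      (h.strictAntiOn_y ⟨hs.1.le, hs.2.le.trans hsm.2⟩ hsm hs.2))

theorem strictAntiOn_ψ (h : IsArc D L x y ψ) {sm : ℝ} (hsm : sm ∈ Icc 0 L)
    (h0 : sm < L → y sm ≤ 0) : StrictAntiOn ψ (Icc sm L) :=
  strictAntiOn_of_derivWithin_Icc h.ode.ψ hsm.1 le_rfl fun _ hs =>
    mul_neg_of_pos_of_neg D.κ_pos ((h.strictAntiOn_y hsm ⟨hsm.1.trans hs.1.le, hs.2.le⟩
      hs.1).trans_le (h0 (hs.1.trans hs.2)))

theorem exists_height (h : IsArc D L x y ψ) {η : ℝ} (hη : η ∈ Icc (y L) (y 0)) :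
    ∃ s ∈ Icc 0 L, y s = η :=
  intermediate_value_Icc' h.pos.le (continuousOn_of_hasDerivWithinAt_Icc h.ode.y) hη

theorem shape (h : IsArc D L x y ψ) {ψm xm um sm : ℝ} (hp : IsProfile D ψm xm um L sm x y ψ) :
    Shape D ψm um (cos ψm + D.κ * um ^ 2 / 2) (y 0) (y L) := by
  obtain ⟨-, -, -, -, hsm, -, hum, hψm, hmax⟩ := hp
  have k := D.κ_pos
  have anti := h.strictAntiOn_y.antitoneOn
  have sq : ∀ η ∈ Icc (y L) (y 0), η ≠ um → um ^ 2 < η ^ 2 := by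
    intro η hη hne
    obtain ⟨s, hs, rfl⟩ := h.exists_height hη
    have hs2 : s ≠ sm := by rintro rfl; exact hne hum
    have h1 := (cos_lt_cos_iff_neg (h.mem s hs) (h.mem sm hsm)).2 (by rw [hψm]; exact hmax s hs hs2)
    have h2 := h.energy hs hsm
    rw [hum] at h2
    nlinarith
  have hmem : um ∈ Icc (y L) (y 0) := by
    rw [← hum]; exact ⟨anti hsm h.L_mem hsm.2, anti h.zero_mem hsm hsm.1⟩
  refine ⟨h.strictAntiOn_y h.zero_mem h.L_mem h.pos, hmem, hψm ▸ h.mem sm hsm, rfl, ?_, ?_, ?_, ?_⟩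
  · have := h.energy h.zero_mem hsm
    rw [h.left, hum, hψm] at this; linarith
  · have := h.energy h.L_mem hsm
    rw [h.right, hum, hψm] at this; linarith
  · intro hlt
    by_contra! hneg
    -- If um were negative and not the top height, the curve would pass the height min (y 0) 0,
    -- which is closer to 0 than um and so has a larger slope angle.
    have h1 : um < min (y 0) 0 := lt_min hlt hneg
    have := sq (min (y 0) 0) ⟨hmem.1.trans h1.le, min_le_left _ _⟩ h1.ne'
    nlinarith [min_le_right (y 0) 0]
  · intro hlt
    by_contra! hneg
    have h1 : max (y L) 0 < um := max_lt hlt hneg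
    have := sq (max (y L) 0) ⟨le_max_left _ _, h1.le.trans hmem.2⟩ h1.ne
    nlinarith [le_max_right (y L) 0]

/-- Change of variables from arc length to height: by the energy, `slopeCot` at height y s is -cot
(ψ s). -/
theorem x_eq (h : IsArc D L x y ψ) {c : ℝ} (hc : c = cos D.ψ₁ + D.κ * y 0 ^ 2 / 2) {s : ℝ}
    (hs : s ∈ Icc 0 L) : x s - x 0 = width D c (y 0) (y s) := by
  have hcos : ∀ r ∈ Icc 0 L, c - D.κ * y r ^ 2 / 2 = cos (ψ r) := by
    intro r hr
    have := h.energy hr h.zero_mem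
    rw [h.left] at this; linarith
  have hsub : uIcc 0 s ⊆ Icc 0 L := by
    rw [uIcc_of_le hs.1]; exact Icc_subset_Icc le_rfl hs.2
  have hψc := h.ode.continuousOn_ψ
  have hyc := continuousOn_of_hasDerivWithinAt_Icc h.ode.y
  have hK : ∀ r ∈ Icc 0 L, slopeCot D c (y r) * sin (ψ r) = -cos (ψ r) := by
    intro r hr
    have := h.sin_neg hr
    have h2 := sin_eq_neg_sqrt (h.mem r hr)
    unfold slopeCot
    rw [hcos r hr, h2]
    have : √(1 - cos (ψ r) ^ 2) ≠ 0 := by intro h0; rw [h2, h0] at this; simp at this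
    field_simp
  have e1 : ∫ r in 0..s, (slopeCot D c ∘ y) r * sin (ψ r) = ∫ η in (y 0)..(y s), slopeCot D c η := by
    refine intervalIntegral.integral_comp_mul_deriv'' (hyc.mono hsub) ?_ ?_ ?_
    · intro r hr
      rw [min_eq_left hs.1, max_eq_right hs.1] at hr
      exact (hasDerivAt_of_mem_Ioo h.ode.y ⟨hr.1, hr.2.trans_le hs.2⟩).hasDerivWithinAt
    · exact continuous_sin.comp_continuousOn (hψc.mono hsub)
    · unfold slopeCot
      refine ContinuousOn.div (by fun_prop) (by fun_prop) ?_
      rintro _ ⟨r, hr, rfl⟩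
      rw [hcos r (hsub hr)]
      have := cos_mem_Ioo (h.mem r (hsub hr))
      refine (Real.sqrt_pos.2 ?_).ne'
      nlinarith [this.1, this.2]
  have e2 : ∫ r in 0..s, (slopeCot D c ∘ y) r * sin (ψ r) = ∫ r in 0..s, -cos (ψ r) :=
    intervalIntegral.integral_congr fun r hr => hK r (hsub hr)
  have e3 := integral_eq_sub_of_derivWithin_Icc hs h.ode.x
    (continuous_cos.comp_continuousOn hψc)
  rw [width, intervalIntegral.integral_symm, ← e1, e2, intervalIntegral.integral_neg, neg_neg, e3]

end IsArc

/-- The energy fixes a² and b². The sign conditions remove the ambiguity: a either equals um or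
exceeds a nonnegative um, and symmetrically for b. -/
theorem Shape.unique {D : Setup} {ψm um c a b c' a' b' : ℝ} (h : Shape D ψm um c a b)
    (h' : Shape D ψm um c' a' b') : c = c' ∧ a = a' ∧ b = b' := by
  have k := D.κ_pos
  have hc : c = c' := by rw [h.energy, h'.energy]
  subst hc
  have e1 : a ^ 2 = a' ^ 2 := by
    have := h.left.symm.trans h'.left
    exact mul_left_cancel₀ k.ne' (by linarith)
  have e2 : b ^ 2 = b' ^ 2 := by
    have := h.right.symm.trans h'.right
    exact mul_left_cancel₀ k.ne' (by linarith)
  refine ⟨rfl, ?_, ?_⟩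
  · rcases h.mem.2.eq_or_lt with ha | ha <;> rcases h'.mem.2.eq_or_lt with ha' | ha'
    · exact ha.symm.trans ha'
    · have := h'.up ha'; rw [← ha] at e1; nlinarith
    · have := h.up ha; rw [← ha'] at e1; nlinarith
    · have h1 := h.up ha; have h2 := h'.up ha'; nlinarith
  · rcases h.mem.1.eq_or_lt with hb | hb <;> rcases h'.mem.1.eq_or_lt with hb' | hb'
    · exact hb.trans hb'.symm
    · have := h'.down hb'; rw [hb] at e2; nlinarith
    · have := h.down hb; rw [hb'] at e2; nlinarith
    · have h1 := h.down hb; have h2 := h'.down hb'; nlinarith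

/-! ### Curves that span the vessel -/

/-- The distance from `O` to the left contact point, for a curve with horizontal and vertical
extents `X` and `Δ`. -/
def radius₁ (D : Setup) (X Δ : ℝ) : ℝ := (X * sin D.θ₂ - Δ * cos D.θ₂) / sin (D.θ₁ + D.θ₂)

/-- The distance from `O` to the right contact point. -/
def radius₂ (D : Setup) (X Δ : ℝ) : ℝ := (X * sin D.θ₁ + Δ * cos D.θ₁) / sin (D.θ₁ + D.θ₂)

/-- The end points lie on the walls, at distances `r₁` and `r₂` from `O`. -/
structure OnWalls (D : Setup) (P₀ L : ℝ) (x y : ℝ → ℝ) (r₁ r₂ : ℝ) : Prop where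
  x_left : x 0 = -(r₁ * cos D.θ₁)
  y_left : y 0 + P₀ / D.g = r₁ * sin D.θ₁
  x_right : x L = r₂ * cos D.θ₂
  y_right : y L + P₀ / D.g = r₂ * sin D.θ₂

theorem sqrt_polar {r θ : ℝ} (hr : 0 < r) : √((r * cos θ) ^ 2 + (r * sin θ) ^ 2) = r := by
  rw [show (r * cos θ) ^ 2 + (r * sin θ) ^ 2 = r ^ 2 by
    linear_combination r ^ 2 * sin_sq_add_cos_sq θ, Real.sqrt_sq hr.le]

/-- The radii come from Cramer's rule, applied to the condition that the displacement between the
contact points is the difference of the two wall vectors. -/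
theorem radius_solves (D : Setup) (X Δ : ℝ) :
    radius₂ D X Δ * cos D.θ₂ + radius₁ D X Δ * cos D.θ₁ = X ∧
    radius₂ D X Δ * sin D.θ₂ - radius₁ D X Δ * sin D.θ₁ = Δ := by
  have hS := D.sin_add_pos
  unfold radius₁ radius₂
  constructor
  · have : X * sin (D.θ₁ + D.θ₂) / sin (D.θ₁ + D.θ₂) = X := by field_simp
    rw [← this, sin_add]
    rw [sin_add] at hS
    field_simp
    ring
  · have : Δ * sin (D.θ₁ + D.θ₂) / sin (D.θ₁ + D.θ₂) = Δ := by field_simp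
    rw [← this, sin_add]
    rw [sin_add] at hS
    field_simp
    ring

theorem OnWalls.radius_eq {D : Setup} {P₀ L : ℝ} {x y : ℝ → ℝ} {r₁ r₂ : ℝ}
    (h : OnWalls D P₀ L x y r₁ r₂) :
    r₁ = radius₁ D (x L - x 0) (y L - y 0) ∧ r₂ = radius₂ D (x L - x 0) (y L - y 0) := by
  have hS := D.sin_add_pos
  have hX : x L - x 0 = r₂ * cos D.θ₂ + r₁ * cos D.θ₁ := by rw [h.x_left, h.x_right]; ring
  have hΔ : y L - y 0 = r₂ * sin D.θ₂ - r₁ * sin D.θ₁ := by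
    linarith [h.y_left, h.y_right]
  unfold radius₁ radius₂
  rw [hX, hΔ, eq_div_iff hS.ne', eq_div_iff hS.ne', sin_add]
  constructor <;> ring

theorem SpansVessel.onWalls {D : Setup} {P₀ L : ℝ} {x y : ℝ → ℝ} (hL : 0 < L)
    (h : SpansVessel D P₀ L x y) : ∃ r₁ > 0, ∃ r₂ > 0, OnWalls D P₀ L x y r₁ r₂ := by
  obtain ⟨ρ, φ, hρ, -, h0, h1⟩ := h
  obtain ⟨a1, a2, a3⟩ := hρ 0 ⟨le_rfl, hL.le⟩
  obtain ⟨b1, b2, b3⟩ := hρ L ⟨hL.le, le_rfl⟩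
  rw [h0] at a2 a3
  rw [h1] at b2 b3
  rw [cos_pi_sub] at a2
  rw [sin_pi_sub] at a3
  exact ⟨_, a1, _, b1, by rw [a2]; ring, a3, b2, b3⟩

/-- The cross product of the unit tangent vector and the position vector from `O`: twice the rate at
which the area between the left wall and the position vector grows. -/
def moment (D : Setup) (P₀ : ℝ) (x y ψ : ℝ → ℝ) (s : ℝ) : ℝ :=
  (y s + P₀ / D.g) * cos (ψ s) - x s * sin (ψ s)

/-- Freezing the direction α gives a function that equals `moment` wherever ψ = α and whose
monotonicity is read off from the sign of ψ - α. The sign of `moment` thus follows by comparison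
with other points of the curve. -/
theorem hasDerivWithinAt_cross {D : Setup} {P₀ L : ℝ} {x y ψ : ℝ → ℝ} (h : SolvesCurve D 0 L x y ψ)
    (α : ℝ) : ∀ s ∈ Icc 0 L, HasDerivWithinAt
      (fun s => (y s + P₀ / D.g) * cos α - x s * sin α) (sin (ψ s - α)) (Icc 0 L) s := by
  intro s hs
  refine ((((h.y s hs).add_const _).mul_const _).sub ((h.x s hs).mul_const _)).congr_deriv ?_
  rw [sin_sub]

namespace IsArc
variable {D : Setup} {L : ℝ} {x y ψ : ℝ → ℝ}

/-- The numerators of the two radii are increments of linear functions of (x, y) with derivatives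
sin (θ₂ - ψ) and sin (θ₁ + ψ), both positive inside the arc. -/
theorem radius_pos (h : IsArc D L x y ψ) :
    0 < radius₁ D (x L - x 0) (y L - y 0) ∧ 0 < radius₂ D (x L - x 0) (y L - y 0) := by
  have hψ₁ : D.ψ₁ < 0 := h.left ▸ (h.mem _ h.zero_mem).2
  have hψ₂ : D.ψ₂ < 0 := h.right ▸ (h.mem _ h.L_mem).2
  have ang : ∀ s ∈ Ioo 0 L, D.θ₁ + ψ s ∈ Ioo 0 π ∧ D.θ₂ - ψ s ∈ Ioo 0 π := fun s hs =>
    Setup.angles_mem_of_lt hψ₁ hψ₂ (h.mem s (Ioo_subset_Icc_self hs)).2 (h.lt_ψ hs)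
  have h1 : StrictMonoOn (fun s => x s * sin D.θ₂ - y s * cos D.θ₂) (Icc 0 L) := by
    refine strictMonoOn_of_derivWithin_Icc (f' := fun s => sin (D.θ₂ - ψ s)) ?_ le_rfl le_rfl
      fun s hs => sin_pos_of_pos_of_lt_pi (ang s hs).2.1 (ang s hs).2.2
    intro s hs
    refine (((h.ode.x s hs).mul_const _).sub ((h.ode.y s hs).mul_const _)).congr_deriv ?_
    rw [sin_sub]; ring
  have h2 : StrictMonoOn (fun s => x s * sin D.θ₁ + y s * cos D.θ₁) (Icc 0 L) := by
    refine strictMonoOn_of_derivWithin_Icc (f' := fun s => sin (D.θ₁ + ψ s)) ?_ le_rfl le_rfl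
      fun s hs => sin_pos_of_pos_of_lt_pi (ang s hs).1.1 (ang s hs).1.2
    intro s hs
    refine (((h.ode.x s hs).mul_const _).add ((h.ode.y s hs).mul_const _)).congr_deriv ?_
    rw [sin_add]; ring
  have h1' := h1 h.zero_mem h.L_mem h.pos
  have h2' := h2 h.zero_mem h.L_mem h.pos
  simp only at h1' h2'
  exact ⟨div_pos (by linarith) D.sin_add_pos, div_pos (by linarith) D.sin_add_pos⟩

/-- Only a weak inequality holds: θ₁ + ψ₁ = γ + π/2, so the moment vanishes at the wall when γ =
±π/2, where the curve is tangent to it. -/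
theorem moment_left {P₀ r₁ r₂ : ℝ} (h : IsArc D L x y ψ) (hw : OnWalls D P₀ L x y r₁ r₂)
    (hr : 0 < r₁) : 0 ≤ moment D P₀ x y ψ 0 := by
  have : moment D P₀ x y ψ 0 = r₁ * sin (D.θ₁ + D.ψ₁) := by
    rw [moment, hw.x_left, hw.y_left, h.left, sin_add]; ring
  rw [this]
  have hψ₁ : D.ψ₁ < 0 := h.left ▸ (h.mem _ h.zero_mem).2
  exact mul_nonneg hr.le (sin_nonneg_of_nonneg_of_le_pi (by linarith [D.neg_θ₁_le_ψ₁])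
    (by linarith [D.θ₁_lt_pi]))

theorem moment_right {P₀ r₁ r₂ : ℝ} (h : IsArc D L x y ψ) (hw : OnWalls D P₀ L x y r₁ r₂)
    (hr : 0 < r₂) : 0 ≤ moment D P₀ x y ψ L := by
  have : moment D P₀ x y ψ L = r₂ * sin (D.θ₂ - D.ψ₂) := by
    rw [moment, hw.x_right, hw.y_right, h.right, sin_sub]; ring
  rw [this]
  have hψ₂ : D.ψ₂ < 0 := h.right ▸ (h.mem _ h.L_mem).2
  exact mul_nonneg hr.le (sin_nonneg_of_nonneg_of_le_pi (by linarith [D.θ₂_nonneg])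
    (by linarith [D.θ₂_sub_pi_le_ψ₂]))

/-- Beyond the maximum ψ decreases, so the cross product with the fixed direction ψ s falls from s
to L. Its value at L is r₂ sin (θ₂ - ψ s) > 0. -/
theorem moment_pos_of_ge {P₀ r₁ r₂ sm s : ℝ} (h : IsArc D L x y ψ)
    (hw : OnWalls D P₀ L x y r₁ r₂) (hr : 0 < r₂) (hsm : sm ∈ Icc 0 L) (h0 : sm < L → y sm ≤ 0)
    (hs : s ∈ Ioo 0 L) (hsms : sm ≤ s) : 0 < moment D P₀ x y ψ s := by
  have hψ₁ : D.ψ₁ < 0 := h.left ▸ (h.mem _ h.zero_mem).2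
  have hψ₂ : D.ψ₂ < 0 := h.right ▸ (h.mem _ h.L_mem).2
  have anti := h.strictAntiOn_ψ hsm h0
  have cross := strictAntiOn_of_derivWithin_Icc (hasDerivWithinAt_cross (P₀ := P₀) h.ode (ψ s))
    hs.1.le le_rfl fun r hr => by
      have hr' : r ∈ Icc 0 L := ⟨hs.1.le.trans hr.1.le, hr.2.le⟩
      have := anti ⟨hsms, hs.2.le⟩ ⟨hsms.trans hr.1.le, hr.2.le⟩ hr.1
      exact sin_neg_of_neg_of_neg_pi_lt (by linarith)
        (by linarith [(h.mem r hr').1, (h.mem s (Ioo_subset_Icc_self hs)).2])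
  have c1 := cross ⟨le_rfl, hs.2.le⟩ ⟨hs.2.le, le_rfl⟩ hs.2
  simp only [hw.x_right, hw.y_right] at c1
  have ang := (Setup.angles_mem_of_lt hψ₁ hψ₂ (h.mem s (Ioo_subset_Icc_self hs)).2 (h.lt_ψ hs)).2
  have c2 := mul_pos hr (sin_pos_of_pos_of_lt_pi ang.1 ang.2)
  rw [sin_sub] at c2
  unfold moment
  linarith

/-- Before the maximum, comparison along the tangent at s goes the wrong way. Instead, the tangent
at s is a positive combination of those at 0 and at sm. The cross product with the first direction
increases on [0, s], that with the second decreases on [s, sm], and both start from nonnegative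
moments at 0 and sm. -/
theorem moment_pos {P₀ r₁ r₂ sm s : ℝ} (h : IsArc D L x y ψ)
    (hw : OnWalls D P₀ L x y r₁ r₂) (hr₁ : 0 < r₁) (hr₂ : 0 < r₂) (hsm : sm ∈ Icc 0 L)
    (h0 : 0 < sm → 0 ≤ y sm) (h1 : sm < L → y sm ≤ 0)
    (hs : s ∈ Ioo 0 L) : 0 < moment D P₀ x y ψ s := by
  rcases le_or_gt sm s with hsms | hsms
  · exact h.moment_pos_of_ge hw hr₂ hsm h1 hs hsms
  have hs' := Ioo_subset_Icc_self hs
  have mono := h.strictMonoOn_ψ hsm h0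
  have hm : 0 ≤ moment D P₀ x y ψ sm := by
    rcases hsm.2.eq_or_lt with hL | hL
    · rw [hL]; exact h.moment_right hw hr₂
    · exact (h.moment_pos_of_ge hw hr₂ hsm h1 ⟨hs.1.trans hsms, hL⟩ le_rfl).le
  have m0 := mono ⟨le_rfl, hsm.1⟩ ⟨hs.1.le, hsms.le⟩ hs.1
  have m1 := mono ⟨hs.1.le, hsms.le⟩ ⟨hsm.1, le_rfl⟩ hsms
  have b0 := h.mem 0 h.zero_mem
  have bs := h.mem s hs'
  have bm := h.mem sm hsm
  have cross0 := strictMonoOn_of_derivWithin_Icc (hasDerivWithinAt_cross (P₀ := P₀) h.ode (ψ 0))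
    le_rfl hs.2.le fun r hr => by
      have hr' : r ∈ Icc 0 L := ⟨hr.1.le, hr.2.le.trans hs.2.le⟩
      have := mono ⟨le_rfl, hsm.1⟩ ⟨hr.1.le, hr.2.le.trans hsms.le⟩ hr.1
      exact sin_pos_of_pos_of_lt_pi (by linarith) (by linarith [(h.mem r hr').2, b0.1])
  have crossm := strictAntiOn_of_derivWithin_Icc (hasDerivWithinAt_cross (P₀ := P₀) h.ode (ψ sm))
    hs.1.le hsm.2 fun r hr => by
      have hr' : r ∈ Icc 0 L := ⟨hs.1.le.trans hr.1.le, hr.2.le.trans hsm.2⟩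
      have := mono ⟨hr'.1, hr.2.le⟩ ⟨hsm.1, le_rfl⟩ hr.2
      exact sin_neg_of_neg_of_neg_pi_lt (by linarith) (by linarith [(h.mem r hr').1, bm.2])
  have c0 := cross0 ⟨le_rfl, hs.1.le⟩ ⟨hs.1.le, le_rfl⟩ hs.1
  have cm := crossm ⟨le_rfl, hsms.le⟩ ⟨hsms.le, le_rfl⟩ hsms
  have w0 := h.moment_left hw hr₁
  unfold moment at w0 hm ⊢
  simp only at c0 cm
  have k0 : 0 < sin (ψ s - ψ 0) := sin_pos_of_pos_of_lt_pi (by linarith) (by linarith [b0.1, bs.2])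
  have k1 : 0 < sin (ψ sm - ψ s) := sin_pos_of_pos_of_lt_pi (by linarith) (by linarith [bs.1, bm.2])
  have k2 : 0 < sin (ψ sm - ψ 0) := sin_pos_of_pos_of_lt_pi (by linarith) (by linarith [b0.1, bm.2])
  -- The two components of the decomposition of the tangent at s.
  have e1 : sin (ψ sm - ψ 0) * cos (ψ s) =
      sin (ψ sm - ψ s) * cos (ψ 0) + sin (ψ s - ψ 0) * cos (ψ sm) := by
    simp only [sin_sub]; ring
  have e2 : sin (ψ sm - ψ 0) * sin (ψ s) =
      sin (ψ sm - ψ s) * sin (ψ 0) + sin (ψ s - ψ 0) * sin (ψ sm) := by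
    simp only [sin_sub]; ring
  refine pos_of_mul_pos_right (a := sin (ψ sm - ψ 0)) ?_ k2.le
  have q1 := mul_pos k0 (hm.trans_lt cm)
  have q2 := mul_pos k1 (w0.trans_lt c0)
  calc (0 : ℝ) < _ := add_pos q1 q2
    _ = (y s + P₀ / D.g) * (sin (ψ sm - ψ s) * cos (ψ 0) + sin (ψ s - ψ 0) * cos (ψ sm)) -
        x s * (sin (ψ sm - ψ s) * sin (ψ 0) + sin (ψ s - ψ 0) * sin (ψ sm)) := by ring
    _ = _ := by rw [← e1, ← e2]; ring

/-- The curve lies in the closed upper half plane about O, so arccos (x/ρ) is its polar angle. The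
derivative of x/ρ is (y + P₀/g) · `moment` / ρ³, which is positive inside. -/
theorem spansVessel {P₀ r₁ r₂ sm : ℝ} (h : IsArc D L x y ψ)
    (hw : OnWalls D P₀ L x y r₁ r₂) (hr₁ : 0 < r₁) (hr₂ : 0 < r₂) (hsm : sm ∈ Icc 0 L)
    (h0 : 0 < sm → 0 ≤ y sm) (h1 : sm < L → y sm ≤ 0) : SpansVessel D P₀ L x y := by
  have hY : ∀ s ∈ Icc 0 L, 0 ≤ y s + P₀ / D.g := by
    intro s hs
    have := h.strictAntiOn_y.antitoneOn hs h.L_mem hs.2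
    have := hw.y_right
    have := mul_nonneg hr₂.le D.sin_θ₂_nonneg
    linarith
  have hYpos : ∀ s ∈ Ioo 0 L, 0 < y s + P₀ / D.g := by
    intro s hs
    have := h.strictAntiOn_y (Ioo_subset_Icc_self hs) h.L_mem hs.2
    have := hY L h.L_mem
    linarith
  have hnorm : ∀ s ∈ Icc 0 L, 0 < x s ^ 2 + (y s + P₀ / D.g) ^ 2 := by
    intro s hs
    rcases hs.1.eq_or_lt with rfl | hs0
    · rw [hw.x_left, hw.y_left]
      have := sin_sq_add_cos_sq D.θ₁
      have : (-(r₁ * cos D.θ₁)) ^ 2 + (r₁ * sin D.θ₁) ^ 2 = r₁ ^ 2 := by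
        linear_combination r₁ ^ 2 * this
      rw [this]; positivity
    · rcases hs.2.eq_or_lt with rfl | hsL
      · rw [hw.x_right, hw.y_right]
        have := sin_sq_add_cos_sq D.θ₂
        have : (r₂ * cos D.θ₂) ^ 2 + (r₂ * sin D.θ₂) ^ 2 = r₂ ^ 2 := by
          linear_combination r₂ ^ 2 * this
        rw [this]; positivity
      · have := hYpos s ⟨hs0, hsL⟩
        positivity
  have polar : ∀ {r θ X Y : ℝ}, 0 < r → θ ∈ Icc 0 π → X = r * cos θ → Y = r * sin θ →
      arccos (X / √(X ^ 2 + Y ^ 2)) = θ := by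
    rintro r θ X Y hr hθ rfl rfl
    rw [sqrt_polar hr, mul_div_cancel_left₀ _ hr.ne', arccos_cos hθ.1 hθ.2]
  set ρ : ℝ → ℝ := fun s => √(x s ^ 2 + (y s + P₀ / D.g) ^ 2) with hρ
  have hρpos : ∀ s ∈ Icc 0 L, 0 < ρ s := fun s hs => Real.sqrt_pos.2 (hnorm s hs)
  have hρsq : ∀ s ∈ Icc 0 L, ρ s ^ 2 = x s ^ 2 + (y s + P₀ / D.g) ^ 2 := fun s hs =>
    Real.sq_sqrt (hnorm s hs).le
  have hbd : ∀ s ∈ Icc 0 L, x s / ρ s ∈ Icc (-1 : ℝ) 1 := by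
    intro s hs
    rw [mem_Icc, ← abs_le, abs_div, abs_of_pos (hρpos s hs), div_le_one (hρpos s hs)]
    exact Real.abs_le_sqrt (by nlinarith [sq_nonneg (y s + P₀ / D.g)])
  refine ⟨ρ, fun s => arccos (x s / ρ s), ?_, ?_, ?_, ?_⟩
  · intro s hs
    have hp := hρpos s hs
    refine ⟨hp, ?_, ?_⟩
    · rw [cos_arccos (hbd s hs).1 (hbd s hs).2]; field_simp
    · rw [sin_arccos, ← Real.sqrt_sq hp.le, ← Real.sqrt_mul (sq_nonneg _), ← Real.sqrt_sq (hY s hs)]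
      congr 1
      rw [Real.sqrt_sq hp.le]
      field_simp
      rw [hρsq s hs]; ring
  · refine strictAntiOn_arccos.comp_strictMonoOn ?_ hbd
    refine strictMonoOn_of_derivWithin_Icc
      (f' := fun s => (y s + P₀ / D.g) * moment D P₀ x y ψ s / ρ s ^ 3) ?_ le_rfl le_rfl ?_
    · intro s hs
      have hp := hρpos s hs
      have hd := (((h.ode.x s hs).pow 2).add (((h.ode.y s hs).add_const (P₀ / D.g)).pow 2)).sqrt
        (hnorm s hs).ne'
      refine ((h.ode.x s hs).div hd hp.ne').congr_deriv ?_
      have e := hρsq s hs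
      change (cos (ψ s) * ρ s - x s * (_ / (2 * ρ s))) / ρ s ^ 2 = _
      unfold moment
      push_cast
      field_simp
      rw [e]
      ring
    · intro s hs
      have := hρpos s (Ioo_subset_Icc_self hs)
      have := h.moment_pos hw hr₁ hr₂ hsm h0 h1 hs
      have := hYpos s hs
      positivity
  · exact polar hr₁ ⟨by linarith [D.θ₁_lt_pi], by linarith [D.θ₁_pos]⟩
      (by rw [cos_pi_sub, hw.x_left]; ring) (by rw [sin_pi_sub, hw.y_left])
  · exact polar hr₂ ⟨D.θ₂_nonneg, D.θ₂_lt_pi.le⟩ hw.x_right hw.y_right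

end IsArc

/-! ### Spanning curves are arcs -/

/-- Only values to the right of s enter, so that the starting point s = 0 is covered. -/
theorem nonpos_of_hasDerivWithinAt_of_nonpos_right {f : ℝ → ℝ} {f' L s : ℝ} (hs : s ∈ Ico 0 L)
    (hf : HasDerivWithinAt f f' (Icc 0 L) s) (h0 : f s = 0) (h : ∀ r ∈ Ioo s L, f r ≤ 0) :
    f' ≤ 0 := by
  have h1 : HasDerivWithinAt f f' (Ioi s) s :=
    (hf.mono Ioo_subset_Icc_self).mono_of_mem_nhdsWithin
      (mem_of_superset (Ioo_mem_nhdsGT hs.2) (Ioo_subset_Ioo_left hs.1))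
  have h2 := (hasDerivWithinAt_iff_tendsto_slope' (by simp)).1 h1
  refine le_of_tendsto h2 ?_
  filter_upwards [Ioo_mem_nhdsGT hs.2] with r hr
  rw [slope_def_field, h0, sub_zero]
  exact div_nonpos_of_nonpos_of_nonneg (h r hr) (by linarith [hr.1])

/-- The cross product of the position vectors at s and at a later r is ρ s · ρ r · sin (φ r - φ s) ≤
0. It vanishes at r = s, where its derivative is -`moment`. -/
theorem SpansVessel.moment_nonneg {D : Setup} {P₀ L : ℝ} {x y ψ : ℝ → ℝ}
    (hode : SolvesCurve D 0 L x y ψ) (h : SpansVessel D P₀ L x y) :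
    ∀ s ∈ Ico 0 L, 0 ≤ moment D P₀ x y ψ s := by
  obtain ⟨ρ, φ, hρ, hφ, h0, h1⟩ := h
  intro s hs
  have hs' := Ico_subset_Icc_self hs
  have hL : 0 ≤ L := hs.1.trans hs.2.le
  have hd : HasDerivWithinAt (fun r => x s * (y r + P₀ / D.g) - (y s + P₀ / D.g) * x r)
      (-moment D P₀ x y ψ s) (Icc 0 L) s := by
    refine ((((hode.y s hs').add_const _).const_mul _).sub
      ((hode.x s hs').const_mul _)).congr_deriv ?_
    unfold moment; ring
  have := nonpos_of_hasDerivWithinAt_of_nonpos_right hs hd (by ring) fun r hr => by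
    have hr' : r ∈ Icc 0 L := ⟨hs.1.trans hr.1.le, hr.2.le⟩
    obtain ⟨a1, a2, a3⟩ := hρ s hs'
    obtain ⟨b1, b2, b3⟩ := hρ r hr'
    have lt := hφ hs' hr' hr.1
    have up := hφ.antitoneOn ⟨le_rfl, hL⟩ hs' hs'.1
    have dn := hφ.antitoneOn hr' ⟨hL, le_rfl⟩ hr'.2
    rw [h0] at up; rw [h1] at dn
    rw [a2, a3, b2, b3]
    have e : ρ s * cos (φ s) * (ρ r * sin (φ r)) - ρ s * sin (φ s) * (ρ r * cos (φ r)) =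
        ρ s * ρ r * sin (φ r - φ s) := by rw [sin_sub]; ring
    rw [e]
    refine mul_nonpos_of_nonneg_of_nonpos (mul_pos a1 b1).le
      (sin_nonpos_of_nonpos_of_neg_pi_le (by linarith) ?_)
    linarith [D.θ₁_pos, D.θ₂_nonneg]
  linarith

/-- Nonnegative moment means sin (φ - ψ) ≥ 0. Since φ - ψ is continuous and at most π at both ends,
it cannot exceed π, whence ψ ≥ φ - π ≥ -π. -/
theorem SpansVessel.isArc {D : Setup} {P₀ L ψm xm um sm : ℝ} {x y ψ : ℝ → ℝ}
    (hψ₁ : D.ψ₁ < 0) (hψm : ψm < 0) (hp : IsProfile D ψm xm um L sm x y ψ)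
    (h : SpansVessel D P₀ L x y) : IsArc D L x y ψ := by
  have hmom := h.moment_nonneg hp.2.1
  obtain ⟨hL, hode, hl, hr, hsm, -, -, hm, hmax⟩ := hp
  obtain ⟨ρ, φ, hρ, hφ, h0, h1⟩ := h
  have zmem : (0 : ℝ) ∈ Icc 0 L := ⟨le_rfl, hL.le⟩
  have Lmem : L ∈ Icc 0 L := ⟨hL.le, le_rfl⟩
  have hφmem : ∀ s ∈ Icc 0 L, φ s ∈ Icc D.θ₂ (π - D.θ₁) := by
    intro s hs
    exact ⟨h1 ▸ hφ.antitoneOn hs Lmem hs.2, h0 ▸ hφ.antitoneOn zmem hs hs.1⟩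
  -- Continuity of φ is not part of the definition; it is recovered from the arccosine formula,
  -- since φ takes values in [0, π].
  have hφcont : ContinuousOn φ (Icc 0 L) := by
    have e : ∀ s ∈ Icc 0 L, φ s = arccos (x s / √(x s ^ 2 + (y s + P₀ / D.g) ^ 2)) := by
      intro s hs
      obtain ⟨a1, a2, a3⟩ := hρ s hs
      have : √(x s ^ 2 + (y s + P₀ / D.g) ^ 2) = ρ s := by rw [a2, a3, sqrt_polar a1]
      rw [this, a2, mul_div_cancel_left₀ _ a1.ne', arccos_cos]
      · exact D.θ₂_nonneg.trans (hφmem s hs).1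
      · linarith [(hφmem s hs).2, D.θ₁_pos]
    refine ContinuousOn.congr ?_ e
    have hx := continuousOn_of_hasDerivWithinAt_Icc hode.x
    have hy := continuousOn_of_hasDerivWithinAt_Icc hode.y
    refine continuous_arccos.comp_continuousOn (hx.div
      (((hx.pow 2).add ((hy.add continuousOn_const).pow 2)).sqrt) ?_)
    intro s hs
    obtain ⟨a1, a2, a3⟩ := hρ s hs
    have : √(x s ^ 2 + (y s + P₀ / D.g) ^ 2) = ρ s := by rw [a2, a3, sqrt_polar a1]
    rw [this]; exact a1.ne'
  have hsin : ∀ s ∈ Ico 0 L, 0 ≤ sin (φ s - ψ s) := by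
    intro s hs
    obtain ⟨a1, a2, a3⟩ := hρ s (Ico_subset_Icc_self hs)
    have := hmom s hs
    have e : moment D P₀ x y ψ s = ρ s * sin (φ s - ψ s) := by
      rw [moment, a2, a3, sin_sub]; ring
    rw [e] at this
    exact nonneg_of_mul_nonneg_right this a1
  have hγ : φ 0 - ψ 0 ≤ π ∧ φ L - ψ L ≤ π := by
    rw [h0, h1, hl, hr]
    have := D.neg_θ₁_le_ψ₁
    have := D.θ₂_sub_pi_le_ψ₂
    constructor <;> linarith
  have hle : ∀ s ∈ Icc 0 L, φ s - ψ s ≤ π := by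
    intro s hs
    by_contra! hcon
    have hsL : s < L := by
      rcases hs.2.eq_or_lt with rfl | h
      · linarith [hγ.2]
      · exact h
    have hc : ContinuousOn (fun t => φ t - ψ t) (Icc 0 s) :=
      (hφcont.sub hode.continuousOn_ψ).mono (Icc_subset_Icc le_rfl hs.2)
    have hpi := pi_pos
    -- The cap 3π/2 yields an intermediate value in (π, 3π/2], where the sine is negative.
    have hmid : min (φ s - ψ s) (3 * π / 2) ∈ Icc (φ 0 - ψ 0) (φ s - ψ s) :=
      ⟨hγ.1.trans (le_min hcon.le (by linarith)), min_le_left _ _⟩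
    obtain ⟨t, ht, hte⟩ := intermediate_value_Icc hs.1 hc hmid
    have h3 := hsin t ⟨ht.1, ht.2.trans_lt hsL⟩
    simp only at hte
    rw [hte] at h3
    have g1 : π < min (φ s - ψ s) (3 * π / 2) := lt_min hcon (by linarith)
    have g2 : min (φ s - ψ s) (3 * π / 2) ≤ 3 * π / 2 := min_le_right _ _
    have : 0 < sin (min (φ s - ψ s) (3 * π / 2) - π) :=
      sin_pos_of_pos_of_lt_pi (by linarith) (by linarith)
    rw [sin_sub_pi] at this
    linarith
  refine ⟨hL, hode, hl, hr, fun s hs => ⟨?_, ?_⟩⟩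
  · have a := hle s hs
    have b := (hφmem s hs).1
    have c := D.θ₂_nonneg
    -- Equality would force φ s = θ₂, hence s = L, but ψ₂ > -π.
    refine lt_of_le_of_ne (by linarith) fun heq => ?_
    have hφs : φ s = φ L := by rw [h1]; linarith
    have : s = L := hφ.injOn hs Lmem hφs
    rw [this, hr] at heq
    have := Setup.neg_pi_lt_ψ₂ hψ₁
    linarith
  · rcases eq_or_ne s sm with rfl | hne
    · rw [hm]; exact hψm
    · exact (hmax s hs hne).trans hψm

/-! ### The enclosed area -/

/-- The map that sends `(s, t)` to the point dividing the segment from `O` to the point of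
parameter `s` in the ratio `t`. -/
def coneMap (D : Setup) (P₀ : ℝ) (x y : ℝ → ℝ) (q : ℝ × ℝ) : ℝ × ℝ :=
  (q.2 * x q.1, -(P₀ / D.g) + q.2 * (y q.1 + P₀ / D.g))

/-- The parameter t = 0 collapses to the single point O, which is null; without it `coneMap` becomes
injective. -/
theorem fluidRegion_eq {D : Setup} {P₀ L : ℝ} {x y : ℝ → ℝ} (hL : 0 < L) :
    fluidRegion D P₀ L x y =
      insert (0, -(P₀ / D.g)) (coneMap D P₀ x y '' (Icc 0 L ×ˢ Ioc (0 : ℝ) 1)) := by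
  ext q
  constructor
  · rintro ⟨s, hs, t, ht, rfl⟩
    rcases ht.1.eq_or_lt with rfl | h0
    · left; simp
    · exact Or.inr ⟨(s, t), ⟨hs, h0, ht.2⟩, rfl⟩
  · rintro (rfl | ⟨⟨s, t⟩, ⟨hs, ht⟩, rfl⟩)
    · exact ⟨0, ⟨le_rfl, hL.le⟩, 0, ⟨le_rfl, zero_le_one⟩, by simp⟩
    · exact ⟨s, hs, t, Ioc_subset_Icc_self ht, rfl⟩

/-- The derivative of `coneMap`. -/
def coneMapDeriv (D : Setup) (P₀ : ℝ) (x y ψ : ℝ → ℝ) (q : ℝ × ℝ) : ℝ × ℝ →L[ℝ] ℝ × ℝ :=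
  (Matrix.toLin (.finTwoProd ℝ) (.finTwoProd ℝ)
    !![q.2 * cos (ψ q.1), x q.1; q.2 * sin (ψ q.1), y q.1 + P₀ / D.g]).toContinuousLinearMap

theorem det_coneMapDeriv (D : Setup) (P₀ : ℝ) (x y ψ : ℝ → ℝ) (q : ℝ × ℝ) :
    (coneMapDeriv D P₀ x y ψ q).det = moment D P₀ x y ψ q.1 * q.2 := by
  unfold coneMapDeriv moment
  simp only [LinearMap.det_toContinuousLinearMap, LinearMap.det_toLin, Matrix.det_fin_two_of]
  ring

theorem hasFDerivWithinAt_coneMap {D : Setup} {P₀ L : ℝ} {x y ψ : ℝ → ℝ}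
    (h : SolvesCurve D 0 L x y ψ) {q : ℝ × ℝ} (hq : q ∈ Icc 0 L ×ˢ Ioc (0 : ℝ) 1) :
    HasFDerivWithinAt (coneMap D P₀ x y) (coneMapDeriv D P₀ x y ψ q) (Icc 0 L ×ˢ Ioc (0 : ℝ) 1) q := by
  have hmaps : MapsTo Prod.fst (Icc 0 L ×ˢ Ioc (0 : ℝ) 1) (Icc 0 L) := fun p hp => hp.1
  have h1 : HasFDerivWithinAt (Prod.fst : ℝ × ℝ → ℝ) (ContinuousLinearMap.fst ℝ ℝ ℝ)
      (Icc 0 L ×ˢ Ioc (0 : ℝ) 1) q := hasFDerivWithinAt_fst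
  have hx := (h.x q.1 hq.1).comp_hasFDerivWithinAt q h1 hmaps
  have hy := ((h.y q.1 hq.1).add_const (P₀ / D.g)).comp_hasFDerivWithinAt q h1 hmaps
  have h2 : HasFDerivWithinAt (Prod.snd : ℝ × ℝ → ℝ) (ContinuousLinearMap.snd ℝ ℝ ℝ)
      (Icc 0 L ×ˢ Ioc (0 : ℝ) 1) q :=
    hasFDerivWithinAt_snd
  unfold coneMapDeriv
  rw [Matrix.toLin_finTwoProd_toContinuousLinearMap]
  convert! (h2.mul hx).prodMk ((h2.mul hy).const_add (-(P₀ / D.g))) using 2 <;>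
  simp [smul_smul, add_comm]

theorem SpansVessel.injOn_coneMap {D : Setup} {P₀ L : ℝ} {x y : ℝ → ℝ}
    (h : SpansVessel D P₀ L x y) : InjOn (coneMap D P₀ x y) (Icc 0 L ×ˢ Ioc (0 : ℝ) 1) := by
  obtain ⟨ρ, φ, hρ, hφ, h0, h1⟩ := h
  rintro ⟨s, t⟩ ⟨hs, ht⟩ ⟨s', t'⟩ ⟨hs', ht'⟩ heq
  simp only at hs ht hs' ht'
  have hL : 0 ≤ L := hs.1.trans hs.2
  obtain ⟨a1, a2, a3⟩ := hρ s hs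
  obtain ⟨b1, b2, b3⟩ := hρ s' hs'
  simp only [coneMap, Prod.mk.injEq, add_right_inj] at heq
  obtain ⟨e1, e2⟩ := heq
  rw [a2, b2] at e1
  rw [a3, b3] at e2
  have hr := sqrt_polar (θ := φ s) (mul_pos ht.1 a1)
  have hr' := sqrt_polar (θ := φ s') (mul_pos ht'.1 b1)
  have hrr : t * ρ s = t' * ρ s' := by
    rw [← hr, ← hr', show t * ρ s * cos (φ s) = t' * ρ s' * cos (φ s') by linarith,
      show t * ρ s * sin (φ s) = t' * ρ s' * sin (φ s') by linarith]
  have hcos : cos (φ s) = cos (φ s') := by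
    refine mul_left_cancel₀ (mul_pos ht.1 a1).ne' ?_
    rw [mul_assoc, e1, hrr, mul_assoc]
  have hmem : ∀ r ∈ Icc 0 L, φ r ∈ Icc 0 π := by
    intro r hr
    have c1 := hφ.antitoneOn hr ⟨hL, le_rfl⟩ hr.2
    have c2 := hφ.antitoneOn ⟨le_rfl, hL⟩ hr hr.1
    rw [h1] at c1; rw [h0] at c2
    exact ⟨by linarith [D.θ₂_nonneg], by linarith [D.θ₁_pos]⟩
  have hss : s = s' := hφ.injOn hs hs' (injOn_cos (hmem s hs) (hmem s' hs') hcos)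
  subst hss
  rw [mul_right_cancel₀ a1.ne' hrr]

/-- Area formula for `coneMap`, whose Jacobian is t · `moment`; integrating t over (0, 1] gives the
factor 1/2. -/
theorem SpansVessel.fluidVolume_eq_integral {D : Setup} {P₀ L : ℝ} {x y ψ : ℝ → ℝ} (hL : 0 < L)
    (hode : SolvesCurve D 0 L x y ψ) (h : SpansVessel D P₀ L x y) :
    fluidVolume D P₀ L x y = (∫ s in 0..L, moment D P₀ x y ψ s) / 2 := by
  have hmeas : MeasurableSet (Icc 0 L ×ˢ Ioc (0 : ℝ) 1) := measurableSet_Icc.prod measurableSet_Ioc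
  have key := integral_image_eq_integral_abs_det_fderiv_smul (E := ℝ × ℝ) volume hmeas
    (fun q hq => hasFDerivWithinAt_coneMap (P₀ := P₀) hode hq) h.injOn_coneMap
    (fun _ => (1 : ℝ))
  have hvol : fluidVolume D P₀ L x y =
      (volume (coneMap D P₀ x y '' (Icc 0 L ×ˢ Ioc (0 : ℝ) 1))).toReal := by
    rw [fluidVolume, fluidRegion_eq hL]
    congr 1
    exact measure_congr (insert_ae_eq_self _ _)
  rw [setIntegral_const] at key
  rw [hvol]
  have e1 : ∫ q in Icc 0 L ×ˢ Ioc (0 : ℝ) 1, |(coneMapDeriv D P₀ x y ψ q).det| • (1 : ℝ) =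
      ∫ q in Ico 0 L ×ˢ Ioc (0 : ℝ) 1, moment D P₀ x y ψ q.1 * q.2 := by
    -- The sign of the moment is available only on [0, L), so the null slice s = L is discarded.
    have : (Icc 0 L ×ˢ Ioc (0 : ℝ) 1 : Set (ℝ × ℝ)) =ᵐ[volume] Ico 0 L ×ˢ Ioc (0 : ℝ) 1 :=
      Measure.set_prod_ae_eq Ico_ae_eq_Icc.symm (ae_eq_refl _)
    rw [setIntegral_congr_set this]
    refine setIntegral_congr_fun (measurableSet_Ico.prod measurableSet_Ioc) fun q hq => ?_
    simp only [smul_eq_mul, mul_one]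
    rw [det_coneMapDeriv, abs_of_nonneg (mul_nonneg (h.moment_nonneg hode q.1 hq.1) hq.2.1.le)]
  rw [e1] at key
  have e2 := setIntegral_prod_mul (μ := volume) (ν := volume) (moment D P₀ x y ψ)
    (fun t : ℝ => t) (Ico 0 L) (Ioc (0 : ℝ) 1)
  have e3 : ∫ t in Ioc (0 : ℝ) 1, t = 1 / 2 := by
    rw [← intervalIntegral.integral_of_le zero_le_one, integral_id]; norm_num
  have e4 : ∫ s in Ico 0 L, moment D P₀ x y ψ s = ∫ s in 0..L, moment D P₀ x y ψ s := by
    rw [intervalIntegral.integral_of_le hL.le, setIntegral_congr_set Ico_ae_eq_Ioc]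
  rw [e3, e4] at e2
  rw [smul_eq_mul, mul_one] at key
  change _ = ∫ q in Ico 0 L ×ˢ Ioc (0 : ℝ) 1, moment D P₀ x y ψ q.1 * q.2 ∂(volume.prod volume)
    at key
  rw [e2] at key
  rw [← Measure.real, key]; ring

/-- The area enclosed by a spanning curve with horizontal extent `X` and end points at heights `a`
and `b`. -/
def areaOf (D : Setup) (X a b : ℝ) : ℝ :=
  (sin D.ψ₂ - sin D.ψ₁) / D.κ + X * (-b + (b - a) * (cos D.θ₁ * sin D.θ₂ / sin (D.θ₁ + D.θ₂)))
    + X ^ 2 * (sin D.θ₁ * sin D.θ₂ / (2 * sin (D.θ₁ + D.θ₂)))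
    + (b - a) ^ 2 * (-(cos D.θ₁ * cos D.θ₂) / (2 * sin (D.θ₁ + D.θ₂)))

theorem continuousOn_moment {D : Setup} {P₀ L : ℝ} {x y ψ : ℝ → ℝ}
    (hode : SolvesCurve D 0 L x y ψ) : ContinuousOn (moment D P₀ x y ψ) (Icc 0 L) := by
  have hx := continuousOn_of_hasDerivWithinAt_Icc hode.x
  have hy := continuousOn_of_hasDerivWithinAt_Icc hode.y
  exact ((hy.add continuousOn_const).mul (continuous_cos.comp_continuousOn hode.continuousOn_ψ)).sub
    (hx.mul (continuous_sin.comp_continuousOn hode.continuousOn_ψ))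

/-- The first two terms are the integral of (y + P₀/g) dx, with P₀/g = r₂ sin θ₂ - b; the last
subtracts the signed triangles below the two walls. -/
theorem areaOf_eq_polygon (D : Setup) (X a b : ℝ) :
    areaOf D X a b = (sin D.ψ₂ - sin D.ψ₁) / D.κ +
      (radius₂ D X (b - a) * sin D.θ₂ - b) * X -
      (radius₂ D X (b - a) * cos D.θ₂ * (radius₂ D X (b - a) * sin D.θ₂) +
        radius₁ D X (b - a) * cos D.θ₁ * (radius₁ D X (b - a) * sin D.θ₁)) / 2 := by
  have hS := D.sin_add_pos
  unfold areaOf radius₁ radius₂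
  rw [sin_add] at hS ⊢
  have k := D.κ_pos
  field_simp
  ring

/-- Because ψ' = κ y, the term y cos ψ has primitive sin ψ / κ, so the whole integrand has an
elementary one. -/
theorem integral_moment {D : Setup} {P₀ L : ℝ} {x y ψ : ℝ → ℝ} {r₁ r₂ : ℝ} (h : IsArc D L x y ψ)
    (hw : OnWalls D P₀ L x y r₁ r₂) :
    (∫ s in 0..L, moment D P₀ x y ψ s) / 2 = areaOf D (x L - x 0) (y 0) (y L) := by
  have k := D.κ_pos
  have hd : ∀ s ∈ Icc 0 L, HasDerivWithinAt (fun s => sin (ψ s) / D.κ + P₀ / D.g * x s -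
      x s * (y s + P₀ / D.g) / 2) (moment D P₀ x y ψ s / 2) (Icc 0 L) s := by
    intro s hs
    refine ((((h.ode.ψ s hs).sin.div_const D.κ).add ((h.ode.x s hs).const_mul _)).sub
      (((h.ode.x s hs).mul ((h.ode.y s hs).add_const _)).div_const 2)).congr_deriv ?_
    unfold moment
    field_simp
    ring
  have e := integral_eq_sub_of_derivWithin_Icc h.L_mem hd
    ((continuousOn_moment h.ode).div_const 2)
  rw [intervalIntegral.integral_div] at e
  rw [e, areaOf_eq_polygon, ← hw.radius_eq.1, ← hw.radius_eq.2, h.left, h.right, hw.y_left,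
    hw.y_right, hw.x_left, hw.x_right]
  have := hw.y_right
  have e3 : P₀ / D.g = r₂ * sin D.θ₂ - y L := by linarith
  rw [e3]
  ring

theorem IsArc.area_pos {D : Setup} {P₀ L sm : ℝ} {x y ψ : ℝ → ℝ} {r₁ r₂ : ℝ} (h : IsArc D L x y ψ)
    (hw : OnWalls D P₀ L x y r₁ r₂) (hr₁ : 0 < r₁) (hr₂ : 0 < r₂) (hsm : sm ∈ Icc 0 L)
    (h0 : 0 < sm → 0 ≤ y sm) (h1 : sm < L → y sm ≤ 0) :
    0 < areaOf D (x L - x 0) (y 0) (y L) := by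
  rw [← integral_moment h hw]
  refine half_pos (intervalIntegral.intervalIntegral_pos_of_pos_on
    (ContinuousOn.intervalIntegrable ?_) (fun s hs => h.moment_pos hw hr₁ hr₂ hsm h0 h1 hs) h.pos)
  rw [uIcc_of_le h.pos.le]
  exact continuousOn_moment h.ode

/-! ### Existence of arcs -/

/-- A differentiable function on the line whose derivative is continuous and at least one has a
differentiable inverse. -/
theorem exists_inverse_of_one_le {G : ℝ → ℝ} (hG : Continuous G) (h1 : ∀ η, 1 ≤ G η) (a : ℝ) :
    ∃ F E : ℝ → ℝ, StrictMono F ∧ F a = 0 ∧ (∀ η, E (F η) = η) ∧ (∀ s, F (E s) = s) ∧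
      ∀ s, HasDerivAt E (G (E s))⁻¹ s := by
  set F : ℝ → ℝ := fun η => ∫ r in a..η, G r with hF
  have hd : ∀ η, HasDerivAt F (G η) η := fun η => hG.integral_hasStrictDerivAt a η |>.hasDerivAt
  have hpos : ∀ η, 0 < G η := fun η => one_pos.trans_le (h1 η)
  have hmono : StrictMono F := strictMono_of_hasDerivAt_pos hd hpos
  have hFa : F a = 0 := by simp [hF]
  have hcont : Continuous F := continuous_iff_continuousAt.2 fun η => (hd η).continuousAt
  have hmono2 : Monotone (fun η => F η - η) :=
    monotone_of_hasDerivAt_nonneg (f' := fun η => G η - 1) (fun η => (hd η).sub (hasDerivAt_id η))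
      (fun η => sub_nonneg.2 (h1 η))
  have hsurj : Function.Surjective F := by
    refine hcont.surjective ?_ ?_
    · refine tendsto_atTop_mono' _ ?_ (tendsto_atTop_add_const_right _ (-a) tendsto_id)
      filter_upwards [eventually_ge_atTop a] with η hη
      have := hmono2 hη
      simp only [hFa] at this
      simp only [id]; linarith
    · refine tendsto_atBot_mono' _ ?_ (tendsto_atBot_add_const_right _ (-a) tendsto_id)
      filter_upwards [eventually_le_atBot a] with η hη
      have := hmono2 hη
      simp only [hFa] at this
      simp only [id]; linarith
  set e := hmono.orderIsoOfSurjective F hsurj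
  have hr : ∀ s, F (e.symm s) = s := fun s => e.apply_symm_apply s
  refine ⟨F, e.symm, hmono, hFa, fun η => e.symm_apply_apply η, hr, fun s => ?_⟩
  exact HasDerivAt.of_local_left_inverse e.symm.continuous.continuousAt (hd _) (hpos _).ne'
    (Eventually.of_forall hr)

/-- The cosine is a decreasing function of η², so its minimum over [b, a] is at an end. The bound
does not depend on c, a, b, which makes later estimates uniform. -/
theorem min_cos_le_of_ends {D : Setup} {c a b η : ℝ} (hl : cos D.ψ₁ = c - D.κ * a ^ 2 / 2)
    (hr : cos D.ψ₂ = c - D.κ * b ^ 2 / 2) (hη : η ∈ Icc b a) :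
    min (cos D.ψ₁) (cos D.ψ₂) ≤ c - D.κ * η ^ 2 / 2 := by
  rw [min_le_iff, hl, hr]
  have k := D.κ_pos
  rcases le_total 0 η with h0 | h0
  · left
    have : η ^ 2 ≤ a ^ 2 := by nlinarith [hη.2]
    nlinarith
  · right
    have : η ^ 2 ≤ b ^ 2 := by nlinarith [hη.1]
    nlinarith

theorem neg_one_lt_min_cos {D : Setup} (hψ₁ : D.ψ₁ < 0) (hψ₂ : D.ψ₂ < 0) :
    -1 < min (cos D.ψ₁) (cos D.ψ₂) :=
  lt_min (cos_mem_Ioo ⟨Setup.neg_pi_lt_ψ₁, hψ₁⟩).1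
    (cos_mem_Ioo ⟨Setup.neg_pi_lt_ψ₂ hψ₁, hψ₂⟩).1

namespace Shape
variable {D : Setup} {ψm um c a b : ℝ}

theorem sq_lt (h : Shape D ψm um c a b) {η : ℝ} (hη : η ∈ Icc b a) (hne : η ≠ um) :
    um ^ 2 < η ^ 2 := by
  rcases hne.lt_or_gt with hlt | hlt
  · have := h.down (hη.1.trans_lt hlt); nlinarith
  · have := h.up (hlt.trans_le hη.2); nlinarith

theorem le_cos (h : Shape D ψm um c a b) {η : ℝ} (hη : η ∈ Icc b a) :
    c - D.κ * η ^ 2 / 2 ≤ cos ψm := by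
  have : um ^ 2 ≤ η ^ 2 := by
    rcases eq_or_ne η um with rfl | hne
    · rfl
    · exact (h.sq_lt hη hne).le
  rw [h.energy]
  nlinarith [D.κ_pos]

theorem cos_mem (h : Shape D ψm um c a b) (hψ₁ : D.ψ₁ < 0) (hψ₂ : D.ψ₂ < 0) {η : ℝ}
    (hη : η ∈ Icc b a) : c - D.κ * η ^ 2 / 2 ∈ Ioo (-1 : ℝ) 1 :=
  ⟨(neg_one_lt_min_cos hψ₁ hψ₂).trans_le (min_cos_le_of_ends h.left h.right hη),
    (h.le_cos hη).trans_lt (cos_mem_Ioo h.angle).2⟩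

/-- The arc is built by quadrature: ds = -dη / √(1 - w²) with w the cosine prescribed by the energy.
Inverting the arc length gives y, then ψ = -arccos w, then x by integration. -/
theorem exists_arc (h : Shape D ψm um c a b) (hψ₁ : D.ψ₁ < 0) (hψ₂ : D.ψ₂ < 0) (x₀ : ℝ) :
    ∃ (L sm : ℝ) (x y ψ : ℝ → ℝ), IsArc D L x y ψ ∧ x 0 = x₀ ∧ y 0 = a ∧ y L = b ∧
      IsProfile D ψm (x sm) um L sm x y ψ := by
  set w : ℝ → ℝ := fun η => c - D.κ * η ^ 2 / 2 with hw
  have hwc : Continuous w := by fun_prop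
  -- Clamping heights to [b, a] makes the integrand continuous on the whole line, beyond the range
  -- where |w| < 1.
  set pr : ℝ → ℝ := fun η => max b (min a η) with hpr
  have hprc : Continuous pr := by fun_prop
  have hprm : ∀ η, pr η ∈ Icc b a := fun η => ⟨le_max_left _ _, max_le h.lt.le (min_le_left _ _)⟩
  have hpre : ∀ η ∈ Icc b a, pr η = η := fun η hη => by
    simp only [hpr]; rw [min_eq_right hη.2, max_eq_right hη.1]
  have hwm : ∀ η ∈ Icc b a, w η ∈ Ioo (-1 : ℝ) 1 := fun η hη => h.cos_mem hψ₁ hψ₂ hη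
  have hpos : ∀ η ∈ Icc b a, 0 < √(1 - w η ^ 2) := fun η hη =>
    Real.sqrt_pos.2 (by nlinarith [(hwm η hη).1, (hwm η hη).2])
  obtain ⟨F, E, hmono, hFa, hEF, hFE, hE⟩ := exists_inverse_of_one_le
    (G := fun η => (√(1 - w (pr η) ^ 2))⁻¹)
    (Continuous.inv₀ (by fun_prop) fun η => (hpos _ (hprm η)).ne')
    (fun η => (one_le_inv₀ (hpos _ (hprm η))).2
      (Real.sqrt_le_one.2 (by nlinarith [sq_nonneg (w (pr η))]))) a
  have hEmono : StrictMono E := fun s t hst => by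
    rwa [← hmono.lt_iff_lt, hFE, hFE]
  have hEc : Continuous E := continuous_iff_continuousAt.2 fun s => (hE s).continuousAt
  set y : ℝ → ℝ := fun s => E (-s) with hy
  set ψ : ℝ → ℝ := fun s => -arccos (w (pr (y s))) with hψ
  have hψc : Continuous ψ := by
    have : Continuous y := hEc.comp continuous_neg
    exact (continuous_arccos.comp (hwc.comp (hprc.comp this))).neg
  set L := -F b with hLdef
  have hLpos : 0 < L := by
    have := hmono h.lt
    rw [hFa] at this; linarith
  have hy0 : y 0 = a := by simp only [hy, neg_zero]; rw [← hFa, hEF]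
  have hyL : y L = b := by simp only [hy, hLdef, neg_neg]; rw [hEF]
  have hym : ∀ s ∈ Icc 0 L, y s ∈ Icc b a := by
    intro s hs
    constructor
    · rw [← hyL]; exact hEmono.monotone (by linarith [hs.2])
    · rw [← hy0]; exact hEmono.monotone (by linarith [hs.1])
  have hcos : ∀ s ∈ Icc 0 L, cos (ψ s) = w (y s) := by
    intro s hs
    have := hwm _ (hym s hs)
    simp only [hψ, cos_neg]
    rw [hpre _ (hym s hs), cos_arccos this.1.le this.2.le]
  have hsin : ∀ s ∈ Icc 0 L, sin (ψ s) = -√(1 - w (y s) ^ 2) := by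
    intro s hs
    simp only [hψ, Real.sin_neg]
    rw [hpre _ (hym s hs), sin_arccos]
  have hψm : ∀ s ∈ Icc 0 L, ψ s ∈ Ioo (-π) 0 := by
    intro s hs
    have := hwm _ (hym s hs)
    simp only [hψ]
    rw [hpre _ (hym s hs)]
    exact ⟨neg_lt_neg (arccos_lt_pi.2 this.1), neg_neg_of_pos (arccos_pos.2 this.2)⟩
  have hangle : ∀ {s t : ℝ}, s ∈ Icc 0 L → t ∈ Ioo (-π) 0 → w (y s) = cos t → ψ s = t := by
    intro s t hs ht he
    rw [← hcos s hs] at he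
    exact strictMonoOn_cos_neg.injOn (Ioo_subset_Icc_self (hψm s hs)) (Ioo_subset_Icc_self ht) he
  have zmem : (0 : ℝ) ∈ Icc 0 L := ⟨le_rfl, hLpos.le⟩
  have Lmem : L ∈ Icc 0 L := ⟨hLpos.le, le_rfl⟩
  have hyd : ∀ s ∈ Icc 0 L, HasDerivAt y (sin (ψ s)) s := by
    intro s hs
    have := (hE (-s)).comp s (hasDerivAt_neg s)
    refine this.congr_deriv ?_
    rw [hsin s hs, inv_inv]
    change √(1 - w (pr (y s)) ^ 2) * -1 = _
    rw [hpre _ (hym s hs)]; ring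
  have hode : SolvesCurve D 0 L (fun s => x₀ + ∫ r in 0..s, cos (ψ r)) y ψ := by
    intro s hs
    refine ⟨?_, (hyd s hs).hasDerivWithinAt, ?_⟩
    · exact (((continuous_cos.comp hψc).integral_hasStrictDerivAt 0 s).hasDerivAt.const_add
        x₀).hasDerivWithinAt
    · have hm := hwm _ (hym s hs)
      have d1 : HasDerivAt (fun s => w (y s)) (-(D.κ * y s * sin (ψ s))) s := by
        refine ((((hyd s hs).pow 2).const_mul D.κ).div_const 2 |>.const_sub c).congr_deriv ?_
        push_cast; ring
      have d2 := (((hasDerivAt_arccos hm.1.ne' hm.2.ne).comp s d1).neg).hasDerivWithinAt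
        (s := Icc 0 L)
      refine (d2.congr (fun t ht => ?_) ?_).congr_deriv ?_
      · simp only [hψ, Function.comp, Pi.neg_apply]; rw [hpre _ (hym t ht)]
      · simp only [hψ, Function.comp, Pi.neg_apply]; rw [hpre _ (hym s hs)]
      · rw [hsin s hs]
        have := hpos _ (hym s hs)
        unfold Setup.κ
        have := D.σ_pos
        field_simp
        ring
  have hleft : ψ 0 = D.ψ₁ := hangle zmem ⟨Setup.neg_pi_lt_ψ₁, hψ₁⟩ (by rw [hy0, h.left])
  have hright : ψ L = D.ψ₂ := hangle Lmem ⟨Setup.neg_pi_lt_ψ₂ hψ₁, hψ₂⟩ (by rw [hyL, h.right])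
  have hsm : -F um ∈ Icc 0 L := by
    have h1 := hmono.monotone h.mem.1
    have h2 := hmono.monotone h.mem.2
    rw [hFa] at h2
    exact ⟨by linarith, by linarith⟩
  have hysm : y (-F um) = um := by simp only [hy, neg_neg]; rw [hEF]
  refine ⟨L, -F um, _, y, ψ, ⟨hLpos, hode, hleft, hright, hψm⟩, by simp, hy0, hyL,
    hLpos, hode, hleft, hright, hsm, rfl, hysm, ?_, ?_⟩
  · exact hangle hsm h.angle (by rw [hysm]; simp only [hw]; rw [h.energy]; ring)
  · intro s hs hne
    rw [← cos_lt_cos_iff_neg (hψm s hs) h.angle, hcos s hs]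
    have hne' : y s ≠ um := by
      intro he
      apply hne
      have : F (y s) = -s := hFE _
      rw [← he, this, neg_neg]
    have := h.sq_lt (hym s hs) hne'
    simp only [hw]
    rw [h.energy]
    nlinarith [D.κ_pos]

end Shape

/-! ### Graphs -/

/-- With S the inverse of x, the slope is p = tan (ψ ∘ S) and p / √(1 + p²) = sin (ψ ∘ S). The chain
rule cancels cos ψ against S' = 1 / cos ψ. -/
theorem isCartesianSolution_of_cos_pos {D : Setup} {P₀ L : ℝ} {x y ψ : ℝ → ℝ} (hL : 0 < L)
    (hode : SolvesCurve D P₀ L x y ψ) (hl : ψ 0 = D.ψ₁) (hr : ψ L = D.ψ₂)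
    (hcos : ∀ s ∈ Icc 0 L, 0 < cos (ψ s)) : IsCartesianSolution D P₀ L x y := by
  have zmem : (0 : ℝ) ∈ Icc 0 L := ⟨le_rfl, hL.le⟩
  have Lmem : L ∈ Icc 0 L := ⟨hL.le, le_rfl⟩
  have hmono : StrictMonoOn x (Icc 0 L) := strictMonoOn_of_derivWithin_Icc hode.x le_rfl le_rfl
    fun s hs => hcos s (Ioo_subset_Icc_self hs)
  have hxc := continuousOn_of_hasDerivWithinAt_Icc hode.x
  set S := Function.invFunOn x (Icc 0 L) with hS
  have hSx : ∀ s ∈ Icc 0 L, S (x s) = s := fun s hs => hmono.injOn.leftInvOn_invFunOn hs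
  have himg : x '' Icc 0 L = Icc (x 0) (x L) := by
    refine Subset.antisymm ?_ (intermediate_value_Icc hL.le hxc)
    rintro _ ⟨s, hs, rfl⟩
    exact ⟨hmono.monotoneOn zmem hs hs.1, hmono.monotoneOn hs Lmem hs.2⟩
  have hSmem : ∀ z ∈ Icc (x 0) (x L), S z ∈ Icc 0 L ∧ x (S z) = z := by
    intro z hz
    rw [← himg] at hz
    exact ⟨Function.invFunOn_mem hz, Function.invFunOn_eq hz⟩
  have hScont : ContinuousOn S (Icc (x 0) (x L)) := by
    -- A continuous injection of a compact interval is an embedding, which gives continuity of the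
    -- inverse.
    have hemb : Topology.IsClosedEmbedding ((Icc 0 L).domRestrict x) :=
      (continuousOn_iff_continuous_domRestrict.1 hxc).isClosedEmbedding
        (injOn_iff_injective.1 hmono.injOn)
    have hg : Continuous fun z : Icc (x 0) (x L) => (⟨S z, (hSmem z z.2).1⟩ : Icc 0 L) := by
      rw [hemb.isInducing.continuous_iff]
      convert! continuous_subtype_val using 1
      ext z
      exact (hSmem z z.2).2
    exact continuousOn_iff_continuous_domRestrict.2 (continuous_subtype_val.comp hg)
  have hSd : ∀ z ∈ Icc (x 0) (x L), HasDerivWithinAt S (cos (ψ (S z)))⁻¹ (Icc (x 0) (x L)) z := by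
    intro z hz
    obtain ⟨m, e⟩ := hSmem z hz
    have ht : Tendsto S (𝓝[Icc (x 0) (x L)] z) (𝓝[Icc 0 L] (S z)) :=
      tendsto_nhdsWithin_iff.2 ⟨hScont z hz, eventually_mem_nhdsWithin.mono fun r hr => (hSmem r hr).1⟩
    have hc := (hcos _ m).ne'
    have := (hode.x _ m).hasFDerivWithinAt.of_comp_of_leftInverse ht (hasFDerivWithinAt_id z _)
      (eventually_mem_nhdsWithin.mono fun r hr => (hSmem r hr).2)
      (f'symm := .toSpanSingleton ℝ (cos (ψ (S z)))⁻¹) (fun _ => by simp [hc]) hz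
    refine this.hasDerivWithinAt.congr_deriv ?_
    simp
  have hmaps : MapsTo S (Icc (x 0) (x L)) (Icc 0 L) := fun z hz => (hSmem z hz).1
  have hp : ∀ s ∈ Icc 0 L, tan (ψ s) / √(1 + tan (ψ s) ^ 2) = sin (ψ s) := by
    intro s hs
    have hc := hcos s hs
    have : √(1 + tan (ψ s) ^ 2) = (cos (ψ s))⁻¹ := by
      rw [← Real.sqrt_sq (inv_pos.2 hc).le]
      congr 1
      rw [tan_eq_sin_div_cos]
      field_simp
      exact cos_sq_add_sin_sq _
    rw [this, tan_eq_sin_div_cos]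
    field_simp
  refine ⟨hmono, y ∘ S, fun s hs => by simp [hSx s hs], hmono zmem Lmem hL,
    fun z => tan (ψ (S z)), fun z hz => ⟨?_, ?_⟩, ?_, ?_⟩
  · obtain ⟨m, e⟩ := hSmem z hz
    refine ((hode.y _ m).comp z (hSd z hz) hmaps).congr_deriv ?_
    exact (tan_eq_sin_div_cos _).symm
  · obtain ⟨m, e⟩ := hSmem z hz
    have hc := (hcos _ m).ne'
    have := ((hode _ m).2.2.sin).comp z (hSd z hz) hmaps
    refine (this.congr (fun r hr => ?_) ?_).congr_deriv ?_
    · exact hp _ (hSmem r hr).1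
    · exact hp _ m
    · simp only [Function.comp]; field_simp
  · simp only [hSx 0 zmem]; rw [hp 0 zmem, hl]
  · simp only [hSx L Lmem]; rw [hp L Lmem, hr]

/-! ### The quantities attached to a shape -/

/-- The abscissa of the left contact point. -/
def leftAbscissa (D : Setup) (c a b : ℝ) : ℝ :=
  -(radius₁ D (width D c a b) (b - a) * cos D.θ₁)

/-- The abscissa of the right contact point. -/
def rightAbscissa (D : Setup) (c a b : ℝ) : ℝ := radius₂ D (width D c a b) (b - a) * cos D.θ₂

/-- The constant `P₀` that fixes the position of the vertex of the vessel. -/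
def pressure (D : Setup) (c a b : ℝ) : ℝ :=
  D.g * (radius₂ D (width D c a b) (b - a) * sin D.θ₂ - b)

/-- The enclosed area. -/
def area (D : Setup) (c a b : ℝ) : ℝ := areaOf D (width D c a b) a b

variable {D : Setup}

theorem IsArc.extent {L : ℝ} {x y ψ : ℝ → ℝ} {ψm um c a b : ℝ} (h : IsArc D L x y ψ)
    (hS : Shape D ψm um c a b) (ha : y 0 = a) (hb : y L = b) : x L - x 0 = width D c a b := by
  rw [h.x_eq (c := c) (by rw [hS.left, ha]; ring) h.L_mem, ha, hb]

theorem IsArc.unimodal {L sm : ℝ} {x y ψ : ℝ → ℝ} {ψm xm um c a b : ℝ} (h : IsArc D L x y ψ)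
    (hS : Shape D ψm um c a b) (ha : y 0 = a) (hb : y L = b)
    (hp : IsProfile D ψm xm um L sm x y ψ) : (0 < sm → 0 ≤ y sm) ∧ (sm < L → y sm ≤ 0) := by
  obtain ⟨-, -, -, -, hsm, -, hum, -, -⟩ := hp
  constructor <;> intro hlt
  · have := h.strictAntiOn_y h.zero_mem hsm hlt
    rw [ha, hum] at this
    rw [hum]; exact hS.up this
  · have := h.strictAntiOn_y hsm h.L_mem hlt
    rw [hb, hum] at this
    rw [hum]; exact hS.down this

theorem Shape.exists_spanning {ψm um c a b : ℝ} (hS : Shape D ψm um c a b) (hψ₁ : D.ψ₁ < 0)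
    (hψ₂ : D.ψ₂ < 0) : ∃ (L sm : ℝ) (x y ψ : ℝ → ℝ), IsArc D L x y ψ ∧
      IsProfile D ψm (leftAbscissa D c a b + width D c a um) um L sm x y ψ ∧
      SpansVessel D (pressure D c a b) L x y ∧ x 0 = leftAbscissa D c a b ∧
      x L = rightAbscissa D c a b ∧ fluidVolume D (pressure D c a b) L x y = area D c a b ∧
      0 < area D c a b := by
  obtain ⟨L, sm, x, y, ψ, h, hx0, ha, hb, hp⟩ := hS.exists_arc hψ₁ hψ₂ (leftAbscissa D c a b)
  have hX := h.extent hS ha hb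
  have hr := h.radius_pos
  rw [hX, ha, hb] at hr
  obtain ⟨s1, s2⟩ := radius_solves D (width D c a b) (b - a)
  have hP : pressure D c a b / D.g = radius₂ D (width D c a b) (b - a) * sin D.θ₂ - b := by
    unfold pressure; have := D.g_pos; field_simp
  have hw : OnWalls D (pressure D c a b) L x y (radius₁ D (width D c a b) (b - a))
      (radius₂ D (width D c a b) (b - a)) := by
    refine ⟨hx0, ?_, ?_, ?_⟩
    · rw [hP, ha]; linarith
    · rw [hx0] at hX; unfold leftAbscissa at hX; linarith
    · rw [hP, hb]; ring
  obtain ⟨u1, u2⟩ := h.unimodal hS ha hb hp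
  have hsm := hp.2.2.2.2.1
  have hspan := h.spansVessel hw hr.1 hr.2 hsm u1 u2
  have hxm : x sm = leftAbscissa D c a b + width D c a um := by
    have := h.x_eq (c := c) (by rw [hS.left, ha]; ring) hsm
    rw [ha, hp.2.2.2.2.2.2.1, hx0] at this
    linarith
  refine ⟨L, sm, x, y, ψ, h, hxm ▸ hp, hspan, hx0, hw.x_right, ?_, ?_⟩
  · rw [hspan.fluidVolume_eq_integral h.pos h.ode, integral_moment h hw, hX, ha, hb, area]
  · have := h.area_pos hw hr.1 hr.2 hsm u1 u2
    rwa [hX, ha, hb] at this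

theorem Realizes.exists_shape {ψm um xm P₀ x₁ x₂ V : ℝ} (hψ₁ : D.ψ₁ < 0) (hψm : ψm < 0)
    (h : Realizes D ψm um xm P₀ x₁ x₂ V) : ∃ c a b, Shape D ψm um c a b := by
  obtain ⟨L, sm, x, y, ψ, hp, hs, -⟩ := h
  exact ⟨_, _, _, (hs.isArc hψ₁ hψm hp).shape hp⟩

/-- A spanning profile is an arc, and uniqueness identifies its shape with the given one. The
heights then give the extent X, and X gives the radii and the position of O. -/
theorem Shape.realizes_iff {ψm um c a b : ℝ} (hS : Shape D ψm um c a b) (hψ₁ : D.ψ₁ < 0)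
    (hψ₂ : D.ψ₂ < 0) (xm P₀ x₁ x₂ V : ℝ) : Realizes D ψm um xm P₀ x₁ x₂ V ↔
      xm = leftAbscissa D c a b + width D c a um ∧ P₀ = pressure D c a b ∧
      x₁ = leftAbscissa D c a b ∧ x₂ = rightAbscissa D c a b ∧ V = area D c a b := by
  constructor
  · rintro ⟨L, sm, x, y, ψ, hp, hs, rfl, rfl, rfl⟩
    have h := hs.isArc hψ₁ hS.angle.2 hp
    obtain ⟨-, ha, hb⟩ := hS.unique (h.shape hp)
    have hX := h.extent hS ha.symm hb.symm
    obtain ⟨r₁, hr₁, r₂, hr₂, hw⟩ := hs.onWalls h.pos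
    obtain ⟨e1, e2⟩ := hw.radius_eq
    rw [hX, ← ha, ← hb] at e1 e2
    have hx0 : x 0 = leftAbscissa D c a b := by rw [hw.x_left, e1, leftAbscissa]
    have hsm := hp.2.2.2.2.1
    refine ⟨?_, ?_, hx0, ?_, ?_⟩
    · have := h.x_eq (c := c) (by rw [hS.left, ha]; ring) hsm
      rw [← ha, hp.2.2.2.2.2.2.1, hp.2.2.2.2.2.1, hx0] at this
      linarith
    · have := hw.y_right
      rw [← hb, e2] at this
      unfold pressure
      rw [← this]
      have := D.g_pos
      field_simp
      ring
    · rw [hw.x_right, e2, rightAbscissa]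
    · rw [hs.fluidVolume_eq_integral h.pos h.ode, integral_moment h hw, hX, ← ha, ← hb, area]
  · rintro ⟨rfl, rfl, rfl, rfl, rfl⟩
    obtain ⟨L, sm, x, y, ψ, -, hp, hs, h0, hL, hV, -⟩ := hS.exists_spanning hψ₁ hψ₂
    exact ⟨L, sm, x, y, ψ, hp, hs, h0, hL, hV⟩

theorem Shape.area_pos {ψm um c a b : ℝ} (hS : Shape D ψm um c a b) (hψ₁ : D.ψ₁ < 0)
    (hψ₂ : D.ψ₂ < 0) : 0 < area D c a b := by
  obtain ⟨L, sm, x, y, ψ, h⟩ := hS.exists_spanning hψ₁ hψ₂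
  exact h.2.2.2.2.2.2

theorem IsArc.cos_pos {L : ℝ} {x y ψ : ℝ → ℝ} (h : IsArc D L x y ψ) (h₁ : -(π / 2) < D.ψ₁)
    (h₂ : -(π / 2) < D.ψ₂) : ∀ s ∈ Icc 0 L, 0 < cos (ψ s) := by
  intro s hs
  refine cos_pos_of_mem_Ioo ⟨?_, by linarith [(h.mem s hs).2, pi_pos]⟩
  rcases hs.1.eq_or_lt with rfl | h0
  · rw [h.left]; exact h₁
  · rcases hs.2.eq_or_lt with rfl | hL
    · rw [h.right]; exact h₂
    · rcases h.lt_ψ ⟨h0, hL⟩ with h3 | h3 <;> linarith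

theorem Shape.hasProfile {ψm um c a b : ℝ} (hS : Shape D ψm um c a b) (hψ₁ : D.ψ₁ < 0)
    (hψ₂ : D.ψ₂ < 0) (xm : ℝ) : HasProfile D ψm xm um := by
  obtain ⟨L, sm, x, y, ψ, h, hx0, ha, hb, hp⟩ := hS.exists_arc hψ₁ hψ₂ (xm - width D c a um)
  have hxm : x sm = xm := by
    have := h.x_eq (c := c) (by rw [hS.left, ha]; ring) hp.2.2.2.2.1
    rw [ha, hp.2.2.2.2.2.2.1, hx0] at this
    linarith
  exact ⟨L, sm, x, y, ψ, hxm ▸ hp, fun h₁ h₂ =>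
    isCartesianSolution_of_cos_pos h.pos h.ode h.left h.right (h.cos_pos h₁ h₂)⟩

theorem Shape.hasSteadySurface {ψm um c a b : ℝ} (hS : Shape D ψm um c a b) (hψ₁ : D.ψ₁ < 0)
    (hψ₂ : D.ψ₂ < 0) : HasSteadySurface D ψm um (area D c a b) := by
  obtain ⟨L, sm, x, y, ψ, h, hp, hs, -, -, hV, -⟩ := hS.exists_spanning hψ₁ hψ₂
  have hode : SolvesCurve D (pressure D c a b) L x
      (fun s => y s + pressure D c a b / D.g) ψ := by
    intro s hs
    obtain ⟨d1, d2, d3⟩ := h.ode s hs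
    refine ⟨d1, d2.add_const _, d3.congr_deriv ?_⟩
    have := D.g_pos
    field_simp
    ring
  exact ⟨_, _, L, sm, x, y, ψ, hp, hs, hV, hode, fun h₁ h₂ =>
    isCartesianSolution_of_cos_pos h.pos hode h.left h.right (h.cos_pos h₁ h₂)⟩

/-! ### Continuity and limits of the area -/

theorem continuousOn_div_sqrt : ContinuousOn (fun u : ℝ => u / √(1 - u ^ 2)) (Ioo (-1) 1) :=
  ContinuousOn.div (by fun_prop) (by fun_prop) fun u hu =>
    (Real.sqrt_pos.2 (by nlinarith [hu.1, hu.2])).ne'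

theorem continuousOn_slopeCot {c a b : ℝ}
    (h : ∀ η ∈ Icc b a, c - D.κ * η ^ 2 / 2 ∈ Ioo (-1 : ℝ) 1) :
    ContinuousOn (slopeCot D c) (Icc b a) :=
  continuousOn_div_sqrt.comp (f := fun η => c - D.κ * η ^ 2 / 2) (by fun_prop) h

theorem continuousOn_width {S : Set ℝ} {c a b : ℝ → ℝ} (hc : ContinuousOn c S)
    (ha : ContinuousOn a S) (hb : ContinuousOn b S) (hab : ∀ p ∈ S, b p ≤ a p)
    (h : ∀ p ∈ S, ∀ η ∈ Icc (b p) (a p), c p - D.κ * η ^ 2 / 2 ∈ Ioo (-1 : ℝ) 1) :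
    ContinuousOn (fun p => width D (c p) (a p) (b p)) S := by
  -- After rescaling to [0, 1], joint continuity is needed for every real t; the clamp keeps the
  -- height in [b p, a p].
  set clamp : ℝ → ℝ := fun t => max 0 (min t 1) with hclamp
  have hclampc : Continuous clamp := by fun_prop
  have hclampm : ∀ t, 0 ≤ clamp t ∧ clamp t ≤ 1 := fun t =>
    ⟨le_max_left _ _, max_le zero_le_one (min_le_right _ _)⟩
  have e : ∀ p ∈ S, width D (c p) (a p) (b p) =
      (a p - b p) * ∫ t in (0 : ℝ)..1, slopeCot D (c p) (b p + (a p - b p) * clamp t) := by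
    intro p hp
    have e1 : ∫ t in (0 : ℝ)..1, slopeCot D (c p) (b p + (a p - b p) * clamp t) =
        ∫ t in (0 : ℝ)..1, slopeCot D (c p) (b p + (a p - b p) * t) := by
      refine intervalIntegral.integral_congr fun t ht => ?_
      rw [uIcc_of_le zero_le_one] at ht
      simp only [hclamp, min_eq_left ht.2, max_eq_right ht.1]
    rw [e1, intervalIntegral.mul_integral_comp_add_mul, width]
    congr 1 <;> ring
  refine ContinuousOn.congr ?_ e
  refine (ha.sub hb).mul ?_
  rw [continuousOn_iff_continuous_domRestrict] at hc ha hb ⊢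
  refine intervalIntegral.continuous_parametric_intervalIntegral_of_continuous'
    (f := fun (p : S) t => slopeCot D (c p) (b p + (a p - b p) * clamp t)) ?_ 0 1
  refine continuousOn_div_sqrt.comp_continuous
    (f := fun q : S × ℝ => c q.1 - D.κ * (b q.1 + (a q.1 - b q.1) * clamp q.2) ^ 2 / 2) ?_ ?_
  · have hc' : Continuous fun q : S × ℝ => c q.1 := hc.comp continuous_fst
    have ha' : Continuous fun q : S × ℝ => a q.1 := ha.comp continuous_fst
    have hb' : Continuous fun q : S × ℝ => b q.1 := hb.comp continuous_fst
    exact hc'.sub ((continuous_const.mul ((hb'.add ((ha'.sub hb').mul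
      (hclampc.comp continuous_snd))).pow 2)).div_const 2)
  · rintro ⟨⟨p, hp⟩, t⟩
    refine h p hp _ ⟨?_, ?_⟩
    · nlinarith [hclampm t, hab p hp]
    · nlinarith [hclampm t, hab p hp]

theorem continuousOn_area {S : Set ℝ} {c a b : ℝ → ℝ} (hc : ContinuousOn c S)
    (ha : ContinuousOn a S) (hb : ContinuousOn b S) (hab : ∀ p ∈ S, b p ≤ a p)
    (h : ∀ p ∈ S, ∀ η ∈ Icc (b p) (a p), c p - D.κ * η ^ 2 / 2 ∈ Ioo (-1 : ℝ) 1) :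
    ContinuousOn (fun p => area D (c p) (a p) (b p)) S := by
  have hX := continuousOn_width hc ha hb hab h
  unfold area areaOf
  fun_prop

/-- The area in terms of the deviation of the curve from its lower end point. -/
theorem Shape.area_eq {ψm um c a b : ℝ} (hS : Shape D ψm um c a b) (hψ₁ : D.ψ₁ < 0)
    (hψ₂ : D.ψ₂ < 0) : area D c a b = (∫ η in b..a, (η - b) * slopeCot D c η) +
      width D c a b * ((b - a) * (cos D.θ₁ * sin D.θ₂ / sin (D.θ₁ + D.θ₂))) +
      width D c a b ^ 2 * (sin D.θ₁ * sin D.θ₂ / (2 * sin (D.θ₁ + D.θ₂))) +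
      (b - a) ^ 2 * (-(cos D.θ₁ * cos D.θ₂) / (2 * sin (D.θ₁ + D.θ₂))) := by
  have hm : ∀ η ∈ Icc b a, c - D.κ * η ^ 2 / 2 ∈ Ioo (-1 : ℝ) 1 :=
    fun η hη => hS.cos_mem hψ₁ hψ₂ hη
  have huIcc : uIcc b a = Icc b a := uIcc_of_le hS.lt.le
  have hc := continuousOn_slopeCot hm
  have i1 : IntervalIntegrable (slopeCot D c) volume b a :=
    ContinuousOn.intervalIntegrable (huIcc ▸ hc)
  have i2 : IntervalIntegrable (fun η => η * slopeCot D c η) volume b a :=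
    ContinuousOn.intervalIntegrable (huIcc ▸ continuousOn_id.mul hc)
  have k := D.κ_pos
  have e1 : ∫ η in b..a, η * slopeCot D c η = (sin D.ψ₂ - sin D.ψ₁) / D.κ := by
    have hd : ∀ η ∈ uIcc b a, HasDerivAt (fun η => √(1 - (c - D.κ * η ^ 2 / 2) ^ 2) / D.κ)
        (η * slopeCot D c η) η := by
      intro η hη
      have hη' := hm η (huIcc ▸ hη)
      have hpos : 0 < 1 - (c - D.κ * η ^ 2 / 2) ^ 2 := by nlinarith [hη'.1, hη'.2]
      have hsq := Real.sqrt_pos.2 hpos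
      have d0 : HasDerivAt (fun η : ℝ => c - D.κ * η ^ 2 / 2) (-(D.κ * η)) η := by
        refine ((((hasDerivAt_id η).pow 2).const_mul D.κ).div_const 2 |>.const_sub c).congr_deriv ?_
        simp; ring
      refine ((((d0.fun_pow 2).const_sub 1).sqrt hpos.ne').div_const D.κ).congr_deriv ?_
      unfold slopeCot
      field_simp
      push_cast
      ring
    rw [intervalIntegral.integral_eq_sub_of_hasDerivAt hd i2, ← hS.left, ← hS.right,
      sin_eq_neg_sqrt ⟨Setup.neg_pi_lt_ψ₁, hψ₁⟩, sin_eq_neg_sqrt ⟨Setup.neg_pi_lt_ψ₂ hψ₁, hψ₂⟩]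
    ring
  have e2 : ∫ η in b..a, (η - b) * slopeCot D c η =
      (sin D.ψ₂ - sin D.ψ₁) / D.κ - b * width D c a b := by
    simp only [sub_mul]
    rw [intervalIntegral.integral_sub i2 (i1.const_mul b), e1,
      intervalIntegral.integral_const_mul, width]
  rw [e2, area, areaOf]
  ring

/-- All terms of `Shape.area_eq` are controlled by a - b, since the cosine stays in a fixed compact
part of (-1, 1). The formula `areaOf` is less suitable, as it contains b itself, which may be
unbounded. -/
theorem tendsto_area_zero (hψ₁ : D.ψ₁ < 0) (hψ₂ : D.ψ₂ < 0) {l : Filter ℝ} {ψm : ℝ}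
    {u c a b : ℝ → ℝ} (hm : ψm ∈ Ioo (-π) 0)
    (hS : ∀ᶠ p in l, Shape D ψm (u p) (c p) (a p) (b p))
    (hab : Tendsto (fun p => a p - b p) l (𝓝 0)) :
    Tendsto (fun p => area D (c p) (a p) (b p)) l (𝓝 0) := by
  obtain ⟨K, hK⟩ := isCompact_Icc.exists_bound_of_continuousOn (continuousOn_div_sqrt.mono
    (Icc_subset_Ioo (neg_one_lt_min_cos hψ₁ hψ₂) (cos_mem_Ioo hm).2))
  have hbound : ∀ {p}, Shape D ψm (u p) (c p) (a p) (b p) → ∀ η ∈ Icc (b p) (a p),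
      ‖slopeCot D (c p) η‖ ≤ K := fun hS η hη =>
    hK _ ⟨min_cos_le_of_ends hS.left hS.right hη, hS.le_cos hη⟩
  have hX : Tendsto (fun p => width D (c p) (a p) (b p)) l (𝓝 0) := by
    refine squeeze_zero_norm' ?_ (by simpa using (hab.abs.const_mul K))
    filter_upwards [hS] with p hp
    refine intervalIntegral.norm_integral_le_of_norm_le_const fun η hη => hbound hp η ?_
    rw [uIoc_of_le hp.lt.le] at hη
    exact Ioc_subset_Icc_self hη
  have hI : Tendsto (fun p => ∫ η in (b p)..(a p), (η - b p) * slopeCot D (c p) η) l (𝓝 0) := by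
    refine squeeze_zero_norm' (a := fun p => (a p - b p) * K * |a p - b p|) ?_
      (by simpa using ((hab.mul_const K).mul hab.abs))
    filter_upwards [hS] with p hp
    refine intervalIntegral.norm_integral_le_of_norm_le_const fun η hη => ?_
    rw [uIoc_of_le hp.lt.le] at hη
    rw [norm_mul, Real.norm_of_nonneg (by linarith [hη.1])]
    exact mul_le_mul (by linarith [hη.2]) (hbound hp η (Ioc_subset_Icc_self hη)) (norm_nonneg _)
      (by linarith [hp.lt])
  have hba : Tendsto (fun p => b p - a p) l (𝓝 0) := by
    simpa using hab.neg
  have key := ((hI.add (hX.mul (hba.mul_const (cos D.θ₁ * sin D.θ₂ / sin (D.θ₁ + D.θ₂))))).add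
    ((hX.pow 2).mul_const (sin D.θ₁ * sin D.θ₂ / (2 * sin (D.θ₁ + D.θ₂))))).add
    ((hba.pow 2).mul_const (-(cos D.θ₁ * cos D.θ₂) / (2 * sin (D.θ₁ + D.θ₂))))
  simp only [zero_mul, add_zero, ne_eq, OfNat.ofNat_ne_zero, not_false_eq_true, zero_pow] at key
  refine key.congr' ?_
  filter_upwards [hS] with p hp
  rw [hp.area_eq hψ₁ hψ₂]

theorem tendsto_sqrt_sq_add_sub {C : ℝ} (hC : 0 < C) :
    Tendsto (fun u : ℝ => √(u ^ 2 + C) - u) atTop (𝓝 0) := by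
  refine squeeze_zero' ?_ ?_ ((tendsto_const_nhds (x := C)).div_atTop tendsto_id)
  · filter_upwards with u
    exact sub_nonneg.2 (Real.le_sqrt_of_sq_le (by linarith))
  · filter_upwards [eventually_gt_atTop 0] with u hu
    rw [sub_le_iff_le_add, Real.sqrt_le_left (by positivity)]
    have : (C / u + u) ^ 2 = (C / u) ^ 2 + 2 * C + u ^ 2 := by field_simp; ring
    simp only [id]
    rw [this]
    nlinarith [sq_nonneg (C / u)]

/-- For heights between √(1 - c) and δ the cosine is at least 1/2 and the sine at most √(2 + κ) η in
modulus, so the integrand exceeds a multiple of 1/η. Elsewhere it is bounded below by a constant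
independent of the shape. -/
theorem width_ge_log (hψ₁ : D.ψ₁ < 0) (hψ₂ : D.ψ₂ < 0) : ∃ K : ℝ, ∀ {ψm c a b δ : ℝ},
    Shape D ψm 0 c a b → 0 < δ → δ ≤ a → D.κ * δ ^ 2 ≤ 1 / 2 → 3 / 4 ≤ c → √(1 - c) ≤ δ →
    1 / (2 * √(2 + D.κ)) * log (δ / √(1 - c)) - K * (a - b) ≤ width D c a b := by
  have k := D.κ_pos
  have hlo := neg_one_lt_min_cos hψ₁ hψ₂
  obtain ⟨K, hK⟩ := isCompact_Icc.exists_bound_of_continuousOn (continuousOn_div_sqrt.mono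
    (Icc_subset_Ioo hlo (zero_lt_one' ℝ)))
  refine ⟨max K 0, fun {ψm c a b δ} hS hδ hδa hκδ hc hcδ => ?_⟩
  have hcm : c = cos ψm := by rw [hS.energy]; ring
  have hc1 : c < 1 := hcm ▸ (cos_mem_Ioo hS.angle).2
  have hs : 0 < √(1 - c) := Real.sqrt_pos.2 (by linarith)
  have hm : ∀ η ∈ Icc b a, c - D.κ * η ^ 2 / 2 ∈ Ioo (-1 : ℝ) 1 :=
    fun η hη => hS.cos_mem hψ₁ hψ₂ hη
  have hcont := continuousOn_slopeCot hm
  have hab := hS.lt.le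
  have i1 : IntervalIntegrable (slopeCot D c) volume b a :=
    ContinuousOn.intervalIntegrable (uIcc_of_le hab ▸ hcont)
  have hge : ∀ η ∈ Icc b a, 0 ≤ slopeCot D c η + max K 0 := by
    intro η hη
    rcases le_total 0 (c - D.κ * η ^ 2 / 2) with h0 | h0
    · have : 0 ≤ slopeCot D c η := div_nonneg h0 (Real.sqrt_nonneg _)
      have := le_max_right K 0
      linarith
    · have := hK _ ⟨min_cos_le_of_ends hS.left hS.right hη, h0⟩
      rw [Real.norm_eq_abs] at this
      have h2 := (abs_le.1 this).1
      have := le_max_left K 0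
      unfold slopeCot
      linarith
  have hb0 : b ≤ 0 := hS.mem.1
  have hsub : ∀ η ∈ Icc (√(1 - c)) δ, η ∈ Icc b a := fun η hη =>
    ⟨hb0.trans (hs.le.trans hη.1), hη.2.trans hδa⟩
  have hlow : ∀ η ∈ Icc (√(1 - c)) δ,
      1 / (2 * √(2 + D.κ)) * η⁻¹ ≤ slopeCot D c η + max K 0 := by
    intro η hη
    have hηpos : 0 < η := hs.trans_le hη.1
    have hmη := hm η (hsub η hη)
    have h1 : 1 - c ≤ η ^ 2 := by
      have := Real.sq_sqrt (show 0 ≤ 1 - c by linarith)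
      nlinarith [hη.1]
    have h2 : η ^ 2 ≤ δ ^ 2 := by nlinarith [hη.2]
    have hu : 1 / 2 ≤ c - D.κ * η ^ 2 / 2 := by nlinarith
    -- With w the cosine, 1 - w² ≤ 2 (1 - w) = 2 (1 - c) + κ η², and 1 - c ≤ η² in this range.
    have hsq : √(1 - (c - D.κ * η ^ 2 / 2) ^ 2) ≤ √(2 + D.κ) * η := by
      rw [← Real.sqrt_sq hηpos.le, ← Real.sqrt_mul (by positivity)]
      refine Real.sqrt_le_sqrt ?_
      rw [Real.sqrt_sq hηpos.le]
      nlinarith [sq_nonneg (1 - (c - D.κ * η ^ 2 / 2))]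
    have hpos : 0 < √(1 - (c - D.κ * η ^ 2 / 2) ^ 2) :=
      Real.sqrt_pos.2 (by nlinarith [hmη.1, hmη.2])
    have : 1 / (2 * √(2 + D.κ)) * η⁻¹ ≤ slopeCot D c η := by
      unfold slopeCot
      calc 1 / (2 * √(2 + D.κ)) * η⁻¹ = (1 / 2) / (√(2 + D.κ) * η) := by
            have : 0 < √(2 + D.κ) := Real.sqrt_pos.2 (by positivity)
            field_simp
        _ ≤ _ := div_le_div₀ (by linarith) hu hpos hsq
    have := le_max_right K 0
    linarith
  have j1 : IntervalIntegrable (fun η => slopeCot D c η + max K 0) volume b a :=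
    i1.add intervalIntegrable_const
  have s1 : ∫ η in √(1 - c)..δ, (slopeCot D c η + max K 0) ≤
      ∫ η in b..a, (slopeCot D c η + max K 0) := by
    refine intervalIntegral.integral_mono_interval (hb0.trans hs.le) hcδ hδa ?_ j1
    filter_upwards [ae_restrict_mem measurableSet_Ioc] with η hη
    exact hge η (Ioc_subset_Icc_self hη)
  have s2 : ∫ η in √(1 - c)..δ, 1 / (2 * √(2 + D.κ)) * η⁻¹ ≤
      ∫ η in √(1 - c)..δ, (slopeCot D c η + max K 0) := by
    refine intervalIntegral.integral_mono_on hcδ ?_ (j1.mono_set ?_) hlow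
    · refine ContinuousOn.intervalIntegrable ?_
      rw [uIcc_of_le hcδ]
      exact continuousOn_const.mul (continuousOn_id.inv₀ fun η hη => (hs.trans_le hη.1).ne')
    · rw [uIcc_of_le hcδ, uIcc_of_le hab]; exact hsub
  rw [intervalIntegral.integral_const_mul, integral_inv_of_pos hs hδ] at s2
  rw [intervalIntegral.integral_add i1 intervalIntegrable_const,
    intervalIntegral.integral_const, smul_eq_mul] at s1
  unfold width
  linarith

/-! ### Extrema and intermediate values -/

/-- Beyond some r the values are below f 0, so the maximum over a compact interval is global.
Continuity at 0 shows that omitting 0 leaves the supremum unchanged. -/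
theorem exists_isGreatest_of_tendsto_zero {f : ℝ → ℝ} (hf : ContinuousOn f (Ici 0))
    (hpos : ∀ u, 0 ≤ u → 0 < f u) (hlim : Tendsto f atTop (𝓝 0)) :
    ∃ V₁, IsGreatest (f '' Ici 0) V₁ ∧ IsLUB (f '' Ioi 0) V₁ ∧
      ∀ V, 0 < V → V ≤ V₁ → ∃ u, 0 ≤ u ∧ f u = V := by
  obtain ⟨r, hr⟩ := eventually_atTop.1 (hlim.eventually_lt_const (hpos 0 le_rfl))
  obtain ⟨q, hq, hmax⟩ := isCompact_Icc.exists_isMaxOn (nonempty_Icc.2 (le_max_right r 0))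
    (hf.mono fun _ hv => hv.1)
  have hle : ∀ u, 0 ≤ u → f u ≤ f q := by
    intro u hu
    rcases le_total u (max r 0) with h | h
    · exact hmax ⟨hu, h⟩
    · exact (hr u ((le_max_left r 0).trans h)).le.trans (hmax ⟨le_rfl, le_max_right r 0⟩)
  refine ⟨f q, ⟨mem_image_of_mem f hq.1, ?_⟩, ⟨?_, ?_⟩, ?_⟩
  · rintro _ ⟨u, hu, rfl⟩; exact hle u hu
  · rintro _ ⟨u, hu, rfl⟩; exact hle u (Ioi_subset_Ici_self hu)
  · intro B hB
    have hc : Tendsto f (𝓝[Ioi 0] q) (𝓝 (f q)) := (hf q hq.1).mono Ioi_subset_Ici_self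
    have : (𝓝[Ioi 0] q).NeBot := mem_closure_iff_nhdsWithin_neBot.1 (by rw [closure_Ioi]; exact hq.1)
    exact le_of_tendsto hc (eventually_mem_nhdsWithin.mono fun u hu => hB (mem_image_of_mem f hu))
  · intro V hV hVq
    obtain ⟨t, ht, hqt⟩ := ((hlim.eventually_lt_const hV).and (eventually_ge_atTop q)).exists
    obtain ⟨u, hu, rfl⟩ := intermediate_value_Icc' hqt
      (hf.mono fun v hv => mem_Ici.2 (hq.1.trans hv.1)) ⟨ht.le, hVq⟩
    exact ⟨u, hq.1.trans hu.1, rfl⟩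

/-- Near 0 the values exceed f M, so the minimum over a compact interval is global on [M, 0). A
value above it is taken strictly to the right of the minimizer, hence in the open interval. -/
theorem exists_isGLB_of_tendsto_atTop {f : ℝ → ℝ} {M : ℝ} (hM : M < 0)
    (hf : ContinuousOn f (Ico M 0)) (hlim : Tendsto f (𝓝[<] 0) atTop) :
    ∃ q ∈ Ico M 0, (∀ t ∈ Ico M 0, f q ≤ f t) ∧ IsGLB (f '' Ioo M 0) (f q) ∧
      ∀ V, f q < V → ∃ t ∈ Ioo M 0, f t = V := by
  obtain ⟨r, hr, hrf⟩ := (mem_nhdsLT_iff_exists_Ioo_subset).1 (hlim.eventually_gt_atTop (f M))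
  have hr0 : max M r < 0 := max_lt hM hr
  obtain ⟨q, hq, hmin⟩ := isCompact_Icc.exists_isMinOn (nonempty_Icc.2 (le_max_left M r))
    (hf.mono fun t ht => ⟨ht.1, ht.2.trans_lt hr0⟩)
  have hq' : q ∈ Ico M 0 := ⟨hq.1, hq.2.trans_lt hr0⟩
  have hle : ∀ t ∈ Ico M 0, f q ≤ f t := by
    intro t ht
    rcases le_or_gt t (max M r) with h | h
    · exact hmin ⟨ht.1, h⟩
    · have : f M < f t := hrf ⟨(le_max_right M r).trans_lt h, ht.2⟩
      exact (show f q ≤ f M from hmin ⟨le_rfl, le_max_left M r⟩).trans this.le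
  refine ⟨q, hq', hle, ⟨?_, ?_⟩, ?_⟩
  · rintro _ ⟨t, ht, rfl⟩; exact hle t (Ioo_subset_Ico_self ht)
  · intro B hB
    have hc : Tendsto f (𝓝[Ioo M 0] q) (𝓝 (f q)) := (hf q hq').mono Ioo_subset_Ico_self
    have : (𝓝[Ioo M 0] q).NeBot := mem_closure_iff_nhdsWithin_neBot.1
      (by rw [closure_Ioo hM.ne]; exact Ico_subset_Icc_self hq')
    exact ge_of_tendsto hc (eventually_mem_nhdsWithin.mono fun u hu => hB (mem_image_of_mem f hu))
  · intro V hV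
    obtain ⟨t, ht, hqt⟩ := ((hlim.eventually_gt_atTop V).and (Ioo_mem_nhdsLT hq'.2)).exists
    obtain ⟨u, hu, rfl⟩ := intermediate_value_Icc hqt.1.le
      (hf.mono fun v hv => ⟨hq'.1.trans hv.1, hv.2.trans_lt hqt.2⟩) ⟨hV.le, ht.le⟩
    have hne : q ≠ u := by rintro rfl; exact hV.ne rfl
    exact ⟨u, ⟨hq'.1.trans_lt (hu.1.lt_of_ne hne), hu.2.trans_lt hqt.2⟩, rfl⟩

/-! ### The three families of shapes -/

/-- The height at which a curve passing the height `u` with slope angle `s` has slope angle `t`,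
up to sign. -/
def heightAt (D : Setup) (s t u : ℝ) : ℝ := √(u ^ 2 + 2 * (cos s - cos t) / D.κ)

theorem heightAt_sq {s t u : ℝ} (h : cos t ≤ cos s) :
    D.κ * heightAt D s t u ^ 2 / 2 = D.κ * u ^ 2 / 2 + (cos s - cos t) := by
  have k := D.κ_pos
  rw [heightAt, Real.sq_sqrt (add_nonneg (sq_nonneg u) (div_nonneg (by linarith) k.le))]
  field_simp

theorem lt_heightAt {s t u : ℝ} (h : cos t < cos s) : |u| < heightAt D s t u := by
  refine Real.lt_sqrt_of_sq_lt ?_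
  rw [sq_abs]
  have : 0 < 2 * (cos s - cos t) / D.κ := div_pos (by linarith) D.κ_pos
  linarith

theorem continuous_heightAt {s t u : ℝ → ℝ} (hs : Continuous s) (ht : Continuous t)
    (hu : Continuous u) : Continuous fun p => heightAt D (s p) (t p) (u p) := by
  unfold heightAt; fun_prop

theorem shape_left (hψ₁ : D.ψ₁ < 0) (h : D.ψ₂ < D.ψ₁) {um : ℝ} (hum : um ≤ 0) :
    Shape D D.ψ₁ um (cos D.ψ₁ + D.κ * um ^ 2 / 2) um (-heightAt D D.ψ₁ D.ψ₂ um) := by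
  have hm₁ : D.ψ₁ ∈ Ioo (-π) 0 := ⟨Setup.neg_pi_lt_ψ₁, hψ₁⟩
  have hm₂ : D.ψ₂ ∈ Ioo (-π) 0 := ⟨Setup.neg_pi_lt_ψ₂ hψ₁, h.trans hψ₁⟩
  have hc := (cos_lt_cos_iff_neg hm₂ hm₁).2 h
  have h1 := lt_heightAt (D := D) (u := um) hc
  have h2 := heightAt_sq (D := D) (u := um) hc.le
  have h3 : -heightAt D D.ψ₁ D.ψ₂ um < um := by linarith [neg_abs_le um]
  exact ⟨h3, ⟨h3.le, le_rfl⟩, hm₁, rfl, by ring, by rw [neg_sq, h2]; ring,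
    fun h => (lt_irrefl _ h).elim, fun _ => hum⟩

theorem shape_right (hψ₁ : D.ψ₁ < 0) (hψ₂ : D.ψ₂ < 0) (h : D.ψ₁ < D.ψ₂) {um : ℝ} (hum : 0 ≤ um) :
    Shape D D.ψ₂ um (cos D.ψ₂ + D.κ * um ^ 2 / 2) (heightAt D D.ψ₂ D.ψ₁ um) um := by
  have hm₁ : D.ψ₁ ∈ Ioo (-π) 0 := ⟨Setup.neg_pi_lt_ψ₁, hψ₁⟩
  have hm₂ : D.ψ₂ ∈ Ioo (-π) 0 := ⟨Setup.neg_pi_lt_ψ₂ hψ₁, hψ₂⟩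
  have hc := (cos_lt_cos_iff_neg hm₁ hm₂).2 h
  have h1 := lt_heightAt (D := D) (u := um) hc
  have h2 := heightAt_sq (D := D) (u := um) hc.le
  have h3 : um < heightAt D D.ψ₂ D.ψ₁ um := by linarith [le_abs_self um]
  exact ⟨h3, ⟨le_rfl, h3.le⟩, hm₂, rfl, by rw [h2]; ring, by ring,
    fun _ => hum, fun h => (lt_irrefl _ h).elim⟩

theorem cos_le_of_max_le (hψ₁ : D.ψ₁ < 0) (hψ₂ : D.ψ₂ < 0) {t : ℝ}
    (ht : t ∈ Ico (max D.ψ₁ D.ψ₂) 0) : cos D.ψ₁ ≤ cos t ∧ cos D.ψ₂ ≤ cos t := by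
  have h1 := (le_max_left _ _).trans ht.1
  have h2 := (le_max_right _ _).trans ht.1
  have k1 : -π < D.ψ₁ := Setup.neg_pi_lt_ψ₁
  have k2 := Setup.neg_pi_lt_ψ₂ hψ₁
  exact ⟨strictMonoOn_cos_neg.monotoneOn ⟨k1.le, hψ₁.le⟩ ⟨by linarith, ht.2.le⟩ h1,
    strictMonoOn_cos_neg.monotoneOn ⟨k2.le, hψ₂.le⟩ ⟨by linarith, ht.2.le⟩ h2⟩

/-- The range includes t = max ψ₁ ψ₂, where one end height is 0 and the maximum sits at a wall;
`hne` excludes that both end heights vanish. -/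
theorem shape_interior (hψ₁ : D.ψ₁ < 0) (hψ₂ : D.ψ₂ < 0) {t : ℝ}
    (ht : t ∈ Ico (max D.ψ₁ D.ψ₂) 0) (hne : D.ψ₁ < t ∨ D.ψ₂ < t) :
    Shape D t 0 (cos t) (heightAt D t D.ψ₁ 0) (-heightAt D t D.ψ₂ 0) := by
  have hm₁ : D.ψ₁ ∈ Ioo (-π) 0 := ⟨Setup.neg_pi_lt_ψ₁, hψ₁⟩
  have hm₂ : D.ψ₂ ∈ Ioo (-π) 0 := ⟨Setup.neg_pi_lt_ψ₂ hψ₁, hψ₂⟩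
  have hm : t ∈ Ioo (-π) 0 := ⟨hm₁.1.trans_le ((le_max_left _ _).trans ht.1), ht.2⟩
  obtain ⟨c1, c2⟩ := cos_le_of_max_le hψ₁ hψ₂ ht
  have e1 := heightAt_sq (D := D) (u := 0) c1
  have e2 := heightAt_sq (D := D) (u := 0) c2
  have n1 : 0 ≤ heightAt D t D.ψ₁ 0 := Real.sqrt_nonneg _
  have n2 : 0 ≤ heightAt D t D.ψ₂ 0 := Real.sqrt_nonneg _
  refine ⟨?_, ⟨by linarith, n1⟩, hm, by ring, by rw [e1]; ring, by rw [neg_sq, e2]; ring,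
    fun _ => le_rfl, fun _ => le_rfl⟩
  rcases hne with h | h
  · have := lt_heightAt (D := D) (u := 0) ((cos_lt_cos_iff_neg hm₁ hm).2 h)
    rw [abs_zero] at this; linarith
  · have := lt_heightAt (D := D) (u := 0) ((cos_lt_cos_iff_neg hm₂ hm).2 h)
    rw [abs_zero] at this; linarith

/-- The area enclosed by the curve with interior maximal slope angle `t`. -/
def interiorArea (D : Setup) (t : ℝ) : ℝ :=
  area D (cos t) (heightAt D t D.ψ₁ 0) (-heightAt D t D.ψ₂ 0)

theorem continuousOn_interiorArea (hψ₁ : D.ψ₁ < 0) (hψ₂ : D.ψ₂ < 0) :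
    ContinuousOn (interiorArea D) (Ico (max D.ψ₁ D.ψ₂) 0) := by
  refine continuousOn_area continuousOn_cos
    (continuous_heightAt continuous_id continuous_const continuous_const).continuousOn
    (continuous_heightAt continuous_id continuous_const continuous_const).neg.continuousOn
    (fun t _ => (neg_nonpos.2 (Real.sqrt_nonneg _)).trans (Real.sqrt_nonneg _)) ?_
  intro t ht η hη
  obtain ⟨c1, c2⟩ := cos_le_of_max_le hψ₁ hψ₂ ht
  have e1 := heightAt_sq (D := D) (u := 0) c1
  have e2 := heightAt_sq (D := D) (u := 0) c2
  refine ⟨(neg_one_lt_min_cos hψ₁ hψ₂).trans_le (min_cos_le_of_ends (by linarith)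
    (by simp only [neg_sq]; linarith) hη), ?_⟩
  have hm : t ∈ Ioo (-π) 0 :=
    ⟨(Setup.neg_pi_lt_ψ₁ (D := D)).trans_le ((le_max_left _ _).trans ht.1), ht.2⟩
  have := (cos_mem_Ioo hm).2
  have := mul_nonneg D.κ_pos.le (sq_nonneg η)
  linarith

theorem interiorArea_eq_zero (h : D.ψ₁ = D.ψ₂) : interiorArea D (max D.ψ₁ D.ψ₂) = 0 := by
  simp [interiorArea, area, areaOf, width, heightAt, h]

/-- The end heights converge to nonzero limits while the width diverges, so the terms containing the
width dominate. -/
theorem tendsto_interiorArea (hψ₁ : D.ψ₁ < 0) (hψ₂ : D.ψ₂ < 0) :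
    Tendsto (interiorArea D) (𝓝[<] 0) atTop := by
  have k := D.κ_pos
  have hS := D.sin_add_pos
  have hM : max D.ψ₁ D.ψ₂ < 0 := max_lt hψ₁ hψ₂
  have ev : ∀ᶠ t in 𝓝[<] (0 : ℝ), t ∈ Ioo (max D.ψ₁ D.ψ₂) 0 := Ioo_mem_nhdsLT hM
  set a : ℝ → ℝ := fun t => heightAt D t D.ψ₁ 0 with ha
  set b : ℝ → ℝ := fun t => -heightAt D t D.ψ₂ 0 with hb
  have hac : Tendsto a (𝓝[<] 0) (𝓝 (a 0)) :=
    (continuous_heightAt continuous_id continuous_const continuous_const).continuousAt.tendsto.mono_left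
      nhdsWithin_le_nhds
  have hbc : Tendsto b (𝓝[<] 0) (𝓝 (b 0)) :=
    (continuous_heightAt continuous_id continuous_const
      continuous_const).neg.continuousAt.tendsto.mono_left nhdsWithin_le_nhds
  have hcos0 : ∀ t ∈ Ioo (-π) 0, cos t < cos 0 := fun t ht => by
    rw [cos_zero]; exact (cos_mem_Ioo ht).2
  have ha0 : 0 < a 0 := by
    have := lt_heightAt (D := D) (u := 0) (hcos0 _ ⟨Setup.neg_pi_lt_ψ₁, hψ₁⟩)
    rwa [abs_zero] at this
  have hb0 : b 0 < 0 := by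
    have := lt_heightAt (D := D) (u := 0) (hcos0 _ ⟨Setup.neg_pi_lt_ψ₂ hψ₁, hψ₂⟩)
    rw [abs_zero] at this
    simp only [hb]; linarith
  have hshape : ∀ t ∈ Ioo (max D.ψ₁ D.ψ₂) 0, Shape D t 0 (cos t) (a t) (b t) := fun t ht =>
    shape_interior hψ₁ hψ₂ (Ioo_subset_Ico_self ht) (Or.inl ((le_max_left _ _).trans_lt ht.1))
  have hX : Tendsto (fun t => width D (cos t) (a t) (b t)) (𝓝[<] 0) atTop := by
    obtain ⟨K, hK⟩ := width_ge_log hψ₁ hψ₂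
    obtain ⟨δ, hδ, hδa, hκδ⟩ : ∃ δ > 0, δ < a 0 ∧ D.κ * δ ^ 2 ≤ 1 / 2 := by
      -- The second bound gives δ ≤ 1 and 2 κ δ ≤ 1, hence κ δ² ≤ 1/2.
      refine ⟨min (a 0 / 2) (1 / (1 + 2 * D.κ)), lt_min (by linarith) (by positivity),
        (min_le_left _ _).trans_lt (by linarith), ?_⟩
      set δ := min (a 0 / 2) (1 / (1 + 2 * D.κ))
      have h0 : 0 < δ := lt_min (by linarith) (by positivity)
      have h1 : δ ≤ 1 / (1 + 2 * D.κ) := min_le_right _ _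
      rw [le_div_iff₀ (by positivity)] at h1
      have h2 : δ ≤ 1 := by nlinarith
      nlinarith
    have hsq : Tendsto (fun t => √(1 - cos t)) (𝓝[<] 0) (𝓝 0) := by
      have : Continuous fun t => √(1 - cos t) := by fun_prop
      simpa using (this.tendsto 0).mono_left nhdsWithin_le_nhds
    have hsq' : Tendsto (fun t => √(1 - cos t)) (𝓝[<] 0) (𝓝[>] 0) := by
      refine tendsto_nhdsWithin_iff.2 ⟨hsq, ev.mono fun t ht => ?_⟩
      exact Real.sqrt_pos.2 (sub_pos.2 (cos_mem_Ioo (hshape t ht).angle).2)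
    have hlog : Tendsto (fun t => 1 / (2 * √(2 + D.κ)) * log (δ / √(1 - cos t))) (𝓝[<] 0) atTop := by
      have hs : 0 < √(2 + D.κ) := Real.sqrt_pos.2 (by positivity)
      refine Tendsto.const_mul_atTop (by positivity) (tendsto_log_atTop.comp ?_)
      simp only [div_eq_mul_inv]
      exact (tendsto_inv_nhdsGT_zero.comp hsq').const_mul_atTop hδ
    have hlow := hlog.atTop_add ((hac.sub hbc).const_mul (-K))
    refine tendsto_atTop_mono' _ ?_ hlow
    have hcosl : Tendsto cos (𝓝[<] 0) (𝓝 1) := by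
      simpa using (continuous_cos.tendsto 0).mono_left nhdsWithin_le_nhds
    filter_upwards [ev, hac.eventually_const_lt hδa, hsq.eventually_lt_const hδ,
      hcosl.eventually_const_lt (show (3 / 4 : ℝ) < 1 by norm_num)] with t ht h1 h2 h3
    have := hK (hshape t ht) hδ h1.le hκδ h3.le h2.le
    linarith
  set q := cos D.θ₁ * sin D.θ₂ / sin (D.θ₁ + D.θ₂) with hq
  set α := sin D.θ₁ * sin D.θ₂ / (2 * sin (D.θ₁ + D.θ₂)) with hα
  set r := -(cos D.θ₁ * cos D.θ₂) / (2 * sin (D.θ₁ + D.θ₂)) with hr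
  have hβ : Tendsto (fun t => -b t + (b t - a t) * q) (𝓝[<] 0)
      (𝓝 (-b 0 + (b 0 - a 0) * q)) := hbc.neg.add ((hbc.sub hac).mul_const q)
  have main : Tendsto (fun t => width D (cos t) (a t) (b t) *
      ((-b t + (b t - a t) * q) + width D (cos t) (a t) (b t) * α)) (𝓝[<] 0) atTop := by
    -- A horizontal right wall kills the quadratic term, and growth is linear with limiting
    -- coefficient -b 0 > 0; otherwise the growth is quadratic.
    rcases D.sin_θ₂_nonneg.eq_or_lt with h0 | h0
    · have hq0 : q = 0 := by simp [hq, ← h0]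
      have hα0 : α = 0 := by simp [hα, ← h0]
      simp only [hq0, hα0, mul_zero, add_zero] at hβ ⊢
      exact hX.atTop_mul_pos (neg_pos.2 hb0) hβ
    · have hαpos : 0 < α := by have := D.sin_θ₁_pos; positivity
      exact hX.atTop_mul_atTop₀ (hβ.add_atTop (hX.atTop_mul_const hαpos))
  have key := (main.atTop_add (((hbc.sub hac).pow 2).mul_const r)).atTop_add
    (tendsto_const_nhds (x := (sin D.ψ₂ - sin D.ψ₁) / D.κ))
  refine key.congr fun t => ?_
  simp only [interiorArea, area, areaOf]
  change _ = (sin D.ψ₂ - sin D.ψ₁) / D.κ + width D (cos t) (a t) (b t) *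
    (-b t + (b t - a t) * q) + width D (cos t) (a t) (b t) ^ 2 * α + (b t - a t) ^ 2 * r
  ring

/-- The area enclosed by the curve with maximal slope angle on the left wall, at height `u`. -/
def leftArea (D : Setup) (u : ℝ) : ℝ :=
  area D (cos D.ψ₁ + D.κ * u ^ 2 / 2) u (-heightAt D D.ψ₁ D.ψ₂ u)

/-- The area enclosed by the curve with maximal slope angle on the right wall, at height `u`. -/
def rightArea (D : Setup) (u : ℝ) : ℝ :=
  area D (cos D.ψ₂ + D.κ * u ^ 2 / 2) (heightAt D D.ψ₂ D.ψ₁ u) u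

theorem continuousOn_leftArea (hψ₁ : D.ψ₁ < 0) (h : D.ψ₂ < D.ψ₁) :
    ContinuousOn (leftArea D) (Iic 0) :=
  continuousOn_area (by fun_prop) continuousOn_id
    (continuous_heightAt continuous_const continuous_const continuous_id).neg.continuousOn
    (fun _ hu => (shape_left hψ₁ h hu).lt.le)
    fun _ hu _ hη => (shape_left hψ₁ h hu).cos_mem hψ₁ (h.trans hψ₁) hη

theorem continuousOn_rightArea (hψ₁ : D.ψ₁ < 0) (hψ₂ : D.ψ₂ < 0) (h : D.ψ₁ < D.ψ₂) :
    ContinuousOn (rightArea D) (Ici 0) :=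
  continuousOn_area (by fun_prop)
    (continuous_heightAt continuous_const continuous_const continuous_id).continuousOn
    continuousOn_id (fun _ hu => (shape_right hψ₁ hψ₂ h hu).lt.le)
    fun _ hu _ hη => (shape_right hψ₁ hψ₂ h hu).cos_mem hψ₁ hψ₂ hη

theorem tendsto_leftArea (hψ₁ : D.ψ₁ < 0) (h : D.ψ₂ < D.ψ₁) :
    Tendsto (leftArea D) atBot (𝓝 0) := by
  have hm₁ : D.ψ₁ ∈ Ioo (-π) 0 := ⟨Setup.neg_pi_lt_ψ₁, hψ₁⟩
  have hm₂ : D.ψ₂ ∈ Ioo (-π) 0 := ⟨Setup.neg_pi_lt_ψ₂ hψ₁, h.trans hψ₁⟩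
  have hC : 0 < 2 * (cos D.ψ₁ - cos D.ψ₂) / D.κ :=
    div_pos (by linarith [(cos_lt_cos_iff_neg hm₂ hm₁).2 h]) D.κ_pos
  refine tendsto_area_zero hψ₁ (h.trans hψ₁) hm₁ (u := id) ?_ ?_
  · filter_upwards [eventually_le_atBot 0] with u hu using shape_left hψ₁ h hu
  · refine ((tendsto_sqrt_sq_add_sub hC).comp tendsto_neg_atBot_atTop).congr fun u => ?_
    simp only [Function.comp, heightAt, neg_sq]
    ring

theorem tendsto_rightArea (hψ₁ : D.ψ₁ < 0) (hψ₂ : D.ψ₂ < 0) (h : D.ψ₁ < D.ψ₂) :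
    Tendsto (rightArea D) atTop (𝓝 0) := by
  have hm₁ : D.ψ₁ ∈ Ioo (-π) 0 := ⟨Setup.neg_pi_lt_ψ₁, hψ₁⟩
  have hm₂ : D.ψ₂ ∈ Ioo (-π) 0 := ⟨Setup.neg_pi_lt_ψ₂ hψ₁, hψ₂⟩
  have hC : 0 < 2 * (cos D.ψ₂ - cos D.ψ₁) / D.κ :=
    div_pos (by linarith [(cos_lt_cos_iff_neg hm₁ hm₂).2 h]) D.κ_pos
  refine tendsto_area_zero hψ₁ hψ₂ hm₂ (u := id) ?_ (tendsto_sqrt_sq_add_sub hC)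
  filter_upwards [eventually_ge_atTop 0] with u hu using shape_right hψ₁ hψ₂ h hu

/-! ### Constraints on the height of the maximum -/

/-- The energy gives um² = a². A positive um would have to equal b, contradicting b < a. -/
theorem Shape.nonpos_of_left {um c a b : ℝ} (h : Shape D D.ψ₁ um c a b) : um ≤ 0 := by
  have k := D.κ_pos
  have e : um ^ 2 = a ^ 2 := by
    have h1 := h.left
    have h2 := h.energy
    exact mul_left_cancel₀ k.ne' (by linarith)
  by_contra! hpos
  have h1 : um = b := by
    by_contra hne
    exact absurd (h.down (lt_of_le_of_ne h.mem.1 (Ne.symm hne))) (not_le.2 hpos)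
  nlinarith [h.lt]

theorem Shape.nonneg_of_right {um c a b : ℝ} (h : Shape D D.ψ₂ um c a b) : 0 ≤ um := by
  have k := D.κ_pos
  have e : um ^ 2 = b ^ 2 := by
    have h1 := h.right
    have h2 := h.energy
    exact mul_left_cancel₀ k.ne' (by linarith)
  by_contra! hneg
  have h1 : um = a := by
    by_contra hne
    exact absurd (h.up (lt_of_le_of_ne h.mem.2 hne)) (not_le.2 hneg)
  nlinarith [h.lt]

/-- At an interior maximum 0 = ψ' = κ um. No spanning assumption is needed. -/
theorem IsProfile.interior {ψm xm um L sm : ℝ} {x y ψ : ℝ → ℝ}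
    (h : IsProfile D ψm xm um L sm x y ψ) (hm : max D.ψ₁ D.ψ₂ < ψm) : sm ∈ Ioo 0 L ∧ um = 0 := by
  obtain ⟨hL, hode, hl, hr, hsm, -, hum, hψm, hmax⟩ := h
  have hs : sm ∈ Ioo 0 L := by
    refine ⟨hsm.1.lt_of_ne ?_, hsm.2.lt_of_ne ?_⟩
    · rintro rfl
      linarith [le_max_left D.ψ₁ D.ψ₂]
    · rintro rfl
      linarith [le_max_right D.ψ₁ D.ψ₂]
  refine ⟨hs, ?_⟩
  have hloc : IsLocalMax ψ sm := by
    filter_upwards [Icc_mem_nhds hs.1 hs.2] with s hs'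
    rcases eq_or_ne s sm with rfl | hne
    · rfl
    · rw [hψm]; exact (hmax s hs' hne).le
  have := hloc.hasDerivAt_eq_zero (hasDerivAt_of_mem_Ioo hode.ψ hs)
  rw [hum] at this
  exact (mul_eq_zero.1 this).resolve_left D.κ_pos.ne'

theorem Realizes.isProfile {ψm um xm P₀ x₁ x₂ V : ℝ} (h : Realizes D ψm um xm P₀ x₁ x₂ V) :
    ∃ (L sm : ℝ) (x y ψ : ℝ → ℝ), IsProfile D ψm xm um L sm x y ψ := by
  obtain ⟨L, sm, x, y, ψ, hp, -⟩ := h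
  exact ⟨L, sm, x, y, ψ, hp⟩

end Capillary

end

/-! ### The main theorem -/

theorem theorem1p3 (D : Capillary.Setup) (hψ₁ : D.ψ₁ < 0) (hψ₂ : D.ψ₂ < 0) :
    -- Case (i), maximal slope angle at the left wall
    (D.ψ₂ < D.ψ₁ →
      (∀ xm um : ℝ, um ≤ 0 → Capillary.HasProfile D D.ψ₁ xm um) ∧
      ∃ Xm 𝒱 P X₁ X₂ : ℝ → ℝ,
        (∀ um xm P₀ x₁ x₂ V : ℝ, Capillary.Realizes D D.ψ₁ um xm P₀ x₁ x₂ V ↔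
          um ≤ 0 ∧ xm = Xm um ∧ P₀ = P um ∧ x₁ = X₁ um ∧ x₂ = X₂ um ∧ V = 𝒱 um) ∧
        Tendsto 𝒱 atBot (𝓝 0) ∧
        ∃ V₁ : ℝ, IsGreatest (𝒱 '' Iic 0) V₁ ∧ IsLUB (𝒱 '' Iio 0) V₁ ∧
          ∀ V : ℝ, 0 < V → V ≤ V₁ →
            ∃ um ≤ 0, 𝒱 um = V ∧ Capillary.HasSteadySurface D D.ψ₁ um V) ∧
    -- Case (i), maximal slope angle at the right wall
    (D.ψ₁ < D.ψ₂ →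
      (∀ xm um : ℝ, 0 ≤ um → Capillary.HasProfile D D.ψ₂ xm um) ∧
      ∃ Xm 𝒱 P X₁ X₂ : ℝ → ℝ,
        (∀ um xm P₀ x₁ x₂ V : ℝ, Capillary.Realizes D D.ψ₂ um xm P₀ x₁ x₂ V ↔
          0 ≤ um ∧ xm = Xm um ∧ P₀ = P um ∧ x₁ = X₁ um ∧ x₂ = X₂ um ∧ V = 𝒱 um) ∧
        Tendsto 𝒱 atTop (𝓝 0) ∧
        ∃ V₁ : ℝ, IsGreatest (𝒱 '' Ici 0) V₁ ∧ IsLUB (𝒱 '' Ioi 0) V₁ ∧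
          ∀ V : ℝ, 0 < V → V ≤ V₁ →
            ∃ um ≥ 0, 𝒱 um = V ∧ Capillary.HasSteadySurface D D.ψ₂ um V) ∧
    -- Case (ii), interior maximal slope angle
    ((∀ ψm ∈ Ioo (max D.ψ₁ D.ψ₂) 0, ∀ (xm um L sm : ℝ) (x y ψ : ℝ → ℝ),
        Capillary.IsProfile D ψm xm um L sm x y ψ → sm ∈ Ioo 0 L ∧ um = 0) ∧
      (∀ ψm ∈ Ioo (max D.ψ₁ D.ψ₂) 0, ∀ xm : ℝ, Capillary.HasProfile D ψm xm 0) ∧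
      ∃ Xm 𝒱 P X₁ X₂ : ℝ → ℝ,
        (∀ ψm ∈ Ioo (max D.ψ₁ D.ψ₂) 0, ∀ um xm P₀ x₁ x₂ V : ℝ,
          Capillary.Realizes D ψm um xm P₀ x₁ x₂ V ↔
            um = 0 ∧ xm = Xm ψm ∧ P₀ = P ψm ∧ x₁ = X₁ ψm ∧ x₂ = X₂ ψm ∧ V = 𝒱 ψm) ∧
        Tendsto 𝒱 (𝓝[<] 0) atTop ∧
        ∃ Vm : ℝ, IsGLB (𝒱 '' Ioo (max D.ψ₁ D.ψ₂) 0) Vm ∧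
          (∀ V : ℝ, Vm < V → ∃ ψm ∈ Ioo (max D.ψ₁ D.ψ₂) 0,
            𝒱 ψm = V ∧ Capillary.HasSteadySurface D ψm 0 V) ∧
          (D.ψ₁ ≠ D.ψ₂ →
            ∃ ψm ∈ Ico (max D.ψ₁ D.ψ₂) 0, Capillary.HasSteadySurface D ψm 0 Vm) ∧
          (D.ψ₁ = D.ψ₂ → Vm = 0)) := by
  refine ⟨fun h => ?_, fun h => ?_, ?_, ?_, ?_⟩
  · refine ⟨fun xm um hum => (Capillary.shape_left hψ₁ h hum).hasProfile hψ₁ hψ₂ xm,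
      fun u => Capillary.leftAbscissa D (cos D.ψ₁ + D.κ * u ^ 2 / 2) u
          (-Capillary.heightAt D D.ψ₁ D.ψ₂ u) +
        Capillary.width D (cos D.ψ₁ + D.κ * u ^ 2 / 2) u u,
      Capillary.leftArea D,
      fun u => Capillary.pressure D (cos D.ψ₁ + D.κ * u ^ 2 / 2) u
        (-Capillary.heightAt D D.ψ₁ D.ψ₂ u),
      fun u => Capillary.leftAbscissa D (cos D.ψ₁ + D.κ * u ^ 2 / 2) u
        (-Capillary.heightAt D D.ψ₁ D.ψ₂ u),
      fun u => Capillary.rightAbscissa D (cos D.ψ₁ + D.κ * u ^ 2 / 2) u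
        (-Capillary.heightAt D D.ψ₁ D.ψ₂ u), ?_, Capillary.tendsto_leftArea hψ₁ h, ?_⟩
    · intro um xm P₀ x₁ x₂ V
      constructor
      · intro hR
        obtain ⟨c, a, b, hS⟩ := hR.exists_shape hψ₁ hψ₁
        have hum := hS.nonpos_of_left
        exact ⟨hum, ((Capillary.shape_left hψ₁ h hum).realizes_iff hψ₁ hψ₂ _ _ _ _ _).1 hR⟩
      · rintro ⟨hum, hR⟩
        exact ((Capillary.shape_left hψ₁ h hum).realizes_iff hψ₁ hψ₂ _ _ _ _ _).2 hR
    -- The reflection u ↦ -u carries (-∞, 0] to [0, ∞).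
    · obtain ⟨V₁, hG, hB, hV⟩ := Capillary.exists_isGreatest_of_tendsto_zero
        (f := Capillary.leftArea D ∘ Neg.neg)
        ((Capillary.continuousOn_leftArea hψ₁ h).comp continuousOn_neg
          fun u hu => mem_Iic.2 (neg_nonpos.2 hu))
        (fun u hu => (Capillary.shape_left hψ₁ h (neg_nonpos.2 hu)).area_pos hψ₁ hψ₂)
        ((Capillary.tendsto_leftArea hψ₁ h).comp tendsto_neg_atTop_atBot)
      rw [image_comp, image_neg_Ici, neg_zero] at hG
      rw [image_comp, image_neg_Ioi, neg_zero] at hB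
      refine ⟨V₁, hG, hB, fun V h0 h1 => ?_⟩
      obtain ⟨u, hu, rfl⟩ := hV V h0 h1
      exact ⟨-u, neg_nonpos.2 hu, rfl,
        (Capillary.shape_left hψ₁ h (neg_nonpos.2 hu)).hasSteadySurface hψ₁ hψ₂⟩
  · refine ⟨fun xm um hum => (Capillary.shape_right hψ₁ hψ₂ h hum).hasProfile hψ₁ hψ₂ xm,
      fun u => Capillary.leftAbscissa D (cos D.ψ₂ + D.κ * u ^ 2 / 2)
          (Capillary.heightAt D D.ψ₂ D.ψ₁ u) u +
        Capillary.width D (cos D.ψ₂ + D.κ * u ^ 2 / 2) (Capillary.heightAt D D.ψ₂ D.ψ₁ u) u,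
      Capillary.rightArea D,
      fun u => Capillary.pressure D (cos D.ψ₂ + D.κ * u ^ 2 / 2)
        (Capillary.heightAt D D.ψ₂ D.ψ₁ u) u,
      fun u => Capillary.leftAbscissa D (cos D.ψ₂ + D.κ * u ^ 2 / 2)
        (Capillary.heightAt D D.ψ₂ D.ψ₁ u) u,
      fun u => Capillary.rightAbscissa D (cos D.ψ₂ + D.κ * u ^ 2 / 2)
        (Capillary.heightAt D D.ψ₂ D.ψ₁ u) u, ?_, Capillary.tendsto_rightArea hψ₁ hψ₂ h, ?_⟩
    · intro um xm P₀ x₁ x₂ V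
      constructor
      · intro hR
        obtain ⟨c, a, b, hS⟩ := hR.exists_shape hψ₁ hψ₂
        have hum := hS.nonneg_of_right
        exact ⟨hum, ((Capillary.shape_right hψ₁ hψ₂ h hum).realizes_iff hψ₁ hψ₂ _ _ _ _ _).1 hR⟩
      · rintro ⟨hum, hR⟩
        exact ((Capillary.shape_right hψ₁ hψ₂ h hum).realizes_iff hψ₁ hψ₂ _ _ _ _ _).2 hR
    · obtain ⟨V₁, hG, hB, hV⟩ := Capillary.exists_isGreatest_of_tendsto_zero
        (Capillary.continuousOn_rightArea hψ₁ hψ₂ h)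
        (fun u hu => (Capillary.shape_right hψ₁ hψ₂ h hu).area_pos hψ₁ hψ₂)
        (Capillary.tendsto_rightArea hψ₁ hψ₂ h)
      refine ⟨V₁, hG, hB, fun V h0 h1 => ?_⟩
      obtain ⟨u, hu, rfl⟩ := hV V h0 h1
      exact ⟨u, hu, rfl, (Capillary.shape_right hψ₁ hψ₂ h hu).hasSteadySurface hψ₁ hψ₂⟩
  · intro ψm hψm xm um L sm x y ψ hp
    exact hp.interior hψm.1
  all_goals
    have hshape : ∀ t ∈ Ioo (max D.ψ₁ D.ψ₂) 0, Capillary.Shape D t 0 (cos t)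
        (Capillary.heightAt D t D.ψ₁ 0) (-Capillary.heightAt D t D.ψ₂ 0) := fun t ht =>
      Capillary.shape_interior hψ₁ hψ₂ (Ioo_subset_Ico_self ht)
        (Or.inl ((le_max_left _ _).trans_lt ht.1))
  · exact fun ψm hψm xm => (hshape ψm hψm).hasProfile hψ₁ hψ₂ xm
  · refine ⟨fun t => Capillary.leftAbscissa D (cos t) (Capillary.heightAt D t D.ψ₁ 0)
          (-Capillary.heightAt D t D.ψ₂ 0) +
        Capillary.width D (cos t) (Capillary.heightAt D t D.ψ₁ 0) 0,
      Capillary.interiorArea D,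
      fun t => Capillary.pressure D (cos t) (Capillary.heightAt D t D.ψ₁ 0)
        (-Capillary.heightAt D t D.ψ₂ 0),
      fun t => Capillary.leftAbscissa D (cos t) (Capillary.heightAt D t D.ψ₁ 0)
        (-Capillary.heightAt D t D.ψ₂ 0),
      fun t => Capillary.rightAbscissa D (cos t) (Capillary.heightAt D t D.ψ₁ 0)
        (-Capillary.heightAt D t D.ψ₂ 0), ?_, Capillary.tendsto_interiorArea hψ₁ hψ₂, ?_⟩
    · intro ψm hψm um xm P₀ x₁ x₂ V
      constructor
      · intro hR
        obtain ⟨L, sm, x, y, ψ, hp⟩ := hR.isProfile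
        obtain ⟨-, rfl⟩ := hp.interior hψm.1
        exact ⟨rfl, ((hshape ψm hψm).realizes_iff hψ₁ hψ₂ _ _ _ _ _).1 hR⟩
      · rintro ⟨rfl, hR⟩
        exact ((hshape ψm hψm).realizes_iff hψ₁ hψ₂ _ _ _ _ _).2 hR
    · have hM : max D.ψ₁ D.ψ₂ < 0 := max_lt hψ₁ hψ₂
      obtain ⟨q, hq, hmin, hglb, hV⟩ := Capillary.exists_isGLB_of_tendsto_atTop hM
        (Capillary.continuousOn_interiorArea hψ₁ hψ₂) (Capillary.tendsto_interiorArea hψ₁ hψ₂)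
      refine ⟨Capillary.interiorArea D q, hglb, fun V hlt => ?_, fun hne => ?_, fun heq => ?_⟩
      · obtain ⟨t, ht, rfl⟩ := hV V hlt
        exact ⟨t, ht, rfl, (hshape t ht).hasSteadySurface hψ₁ hψ₂⟩
      -- The minimizer may be the left end point of the interval; for ψ₁ ≠ ψ₂ the shape there is
      -- still nondegenerate.
      · refine ⟨q, hq, (Capillary.shape_interior hψ₁ hψ₂ hq ?_).hasSteadySurface hψ₁ hψ₂⟩
        rcases hne.lt_or_gt with h | h
        · exact Or.inl (h.trans_le ((le_max_right _ _).trans hq.1))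
        · exact Or.inr (h.trans_le ((le_max_left _ _).trans hq.1))
      -- For ψ₁ = ψ₂ the curve shrinks to a point at the left end point, where the continuous
      -- extension of the area vanishes; inside the interval areas are positive.
      · refine le_antisymm ?_ (hglb.2 ?_)
        · rw [← Capillary.interiorArea_eq_zero heq]
          exact hmin _ ⟨le_rfl, hM⟩
        · rintro _ ⟨t, ht, rfl⟩
          exact ((hshape t ht).area_pos hψ₁ hψ₂).le
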